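/- Let $I\subseteq\mathbb{R}$ be an interval with more than one point and $I\neq\mathbb{R}$ (for instance $I=[0,\infty)$). For a unital $C^*$-algebra $A$, let $P_A=P_A(I)$ be the set of all real-valued continuous functions $f$ on $I$ such that $x\le y$ implies $f(x)\le f(y)$ (continuous functional calculus) for all self-adjoint $x,y\in A$ with spectrum in $I$. For a positive integer $n$ let $P_n=P_{M_n}$, where $M_n$ is the $C^*$-algebra of complex $n\times n$ matrices, and let $P_\infty=\bigcap_{n\ge1}P_n$. Let $A$ be a unital $C^*$-algebra. Then: (1) $P_A=P_\infty$ if and only if either the set of dimensions of the finite-dimensional irreducible representations of $A$ is unbounded, or $A$ has an infinite-dimensional irreducible representation. Equally, for every infinite-dimensional complex Hilbert space $H$, one has $P_A=P_{B(H)}$ (the class of operator monotone functions) if and only if the same condition on $A$ holds. (2) For every positive integer $n$, $P_A=P_n$ if and only if $A$ is $n$-subhomogeneous, i.e. all irreducible representations of $A$ are finite-dimensional and $n$ is the largest of their dimensions. -/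

import Mathlib

universe u v

/-- The class `P_A(I)`, for a unital C⋆-algebra `A` with its standard partial order, of all real
functions that are continuous on `I` and satisfy `x ≤ y → f x ≤ f y` for all self-adjoint `x`, `y`
in `A` with spectrum in `I`. A function on `I` is represented by a function on `ℝ`; membership
depends only on the values on `I`. -/
def monotoneClass (A : Type u) [CStarAlgebra A] [PartialOrder A] [StarOrderedRing A]
    (I : Set ℝ) : Set (ℝ → ℝ) :=
  {f | ContinuousOn f I ∧
    ∀ x y : A, IsSelfAdjoint x → IsSelfAdjoint y → spectrum ℝ x ⊆ I → spectrum ℝ y ⊆ I →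
      x ≤ y → cfc f x ≤ cfc f y}

open scoped Matrix.Norms.L2Operator MatrixOrder in
/-- The class `P_n(I)` of matrix monotone functions of order `n`: the class `P_A(I)` for the
C⋆-algebra `A = M_n` of complex `n × n` matrices. -/
def matrixMonotoneClass (n : ℕ) (I : Set ℝ) : Set (ℝ → ℝ) :=
  monotoneClass (Matrix (Fin n) (Fin n) ℂ) I

/-- The class `P_∞(I)`, the intersection of all `P_n(I)` with `n ≥ 1`. -/
def infMonotoneClass (I : Set ℝ) : Set (ℝ → ℝ) :=
  ⋂ n : ℕ, ⋂ _ : 1 ≤ n, matrixMonotoneClass n I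

/-- A (unital) representation `π` of `A` on `H` is irreducible if `H ≠ 0` and the only closed
subspaces of `H` invariant under `π` are `0` and `H`. -/
def IsIrreducibleRep {A : Type u} [CStarAlgebra A] {H : Type v} [NormedAddCommGroup H]
    [InnerProductSpace ℂ H] [CompleteSpace H] (π : A →⋆ₐ[ℂ] (H →L[ℂ] H)) : Prop :=
  Nontrivial H ∧ ∀ K : Submodule ℂ H, IsClosed (K : Set H) →
    (∀ a : A, ∀ ξ ∈ K, π a ξ ∈ K) → K = ⊥ ∨ K = ⊤

/-- The set of dimensions of the finite-dimensional irreducible representations of `A`. An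
irreducible representation is cyclic, so up to unitary equivalence it acts on a Hilbert space in
the universe of `A`. -/
def finiteIrrepDims (A : Type u) [CStarAlgebra A] : Set ℕ :=
  {d | ∃ (H : Type u) (_ : NormedAddCommGroup H) (_ : InnerProductSpace ℂ H)
      (_ : CompleteSpace H) (π : A →⋆ₐ[ℂ] (H →L[ℂ] H)),
      IsIrreducibleRep π ∧ FiniteDimensional ℂ H ∧ Module.finrank ℂ H = d}

/-- `A` has an infinite-dimensional irreducible representation. -/
def HasInfiniteDimIrrep (A : Type u) [CStarAlgebra A] : Prop :=
  ∃ (H : Type u) (_ : NormedAddCommGroup H) (_ : InnerProductSpace ℂ H)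
    (_ : CompleteSpace H) (π : A →⋆ₐ[ℂ] (H →L[ℂ] H)),
    IsIrreducibleRep π ∧ ¬ FiniteDimensional ℂ H

/-- `A` is `n`-subhomogeneous: all its irreducible representations are finite-dimensional, and `n`
is the largest of their dimensions. -/
def IsSubhomogeneousOfDegree (A : Type u) [CStarAlgebra A] (n : ℕ) : Prop :=
  ¬ HasInfiniteDimIrrep A ∧ IsGreatest (finiteIrrepDims A) n

/-! The class `P_A` is determined by the Hilbert spaces that carry irreducible representations of
`A`. On one side, irreducible representations detect positivity (Krein–Milman on the state space,
then GNS: `exists_irreducibleRep_not_nonneg`), so a function that is monotone on `B(H)` for each of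
these spaces is monotone on `A`. On the other side, a Kaplansky density argument makes every pair `α
≤ X ≤ Y ≤ β` in `B(H)` a bounded strong limit of images of such pairs from `A`; the functional
calculus is strongly continuous on bounded sets and the order is strongly closed, so `P_A ⊆
P_{B(H)}` (`IsIrreducibleRep.monotoneClass_subset`).

For `B(H)` only the dimension matters. An isometry `K → H` gives `P_{B(H)} ⊆ P_{B(K)}`
(`LinearIsometry.monotoneClass_subset`), and finite-dimensional corners converge strongly, so
`P_{B(H)} = P_∞` when `H` is infinite-dimensional. Hence `P_A` is `P_n` for the largest dimension
`n`, or `P_∞`.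

The two equivalences then reduce to `P_n ≠ P_{n+1}`
(`exists_mem_euclideanMonotoneClass_notMem_succ`). For `p = ∑ c_k x^(k+1)` the derivative of `⟪η,
p(z) η⟫` in the direction `b⋆b` is the Hankel form `∑ c_{i+j} re ⟪v_i, v_j⟫` with `v_i = b z^i η`.
Take `c_k = (2n)^(k²)` for `k < 2n` and no further terms. In dimension `n`, for small `z`,
Cayley–Hamilton makes `v_i` negligible for `i ≥ n`, and the leading `n × n` block is positive
definite. In dimension `n + 1` the corner entry `c_{2n}` is missing, and a suitable choice of
moments makes the form negative. A fractional linear change of variable, available because `I ≠ ℝ`,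
carries the example from a neighbourhood of `0` to `I`. -/

/-! ### Real functional calculus under star homomorphisms -/

theorem spectrum_real_map_subset {A : Type u} [CStarAlgebra A] {B : Type v} [CStarAlgebra B]
    (φ : A →⋆ₐ[ℂ] B) (x : A) : spectrum ℝ (φ x) ⊆ spectrum ℝ x :=
  AlgHom.spectrum_apply_subset (φ.toAlgHom.restrictScalars ℝ) x

theorem map_algebraMap_real {A : Type u} [CStarAlgebra A] {B : Type v} [CStarAlgebra B]
    (φ : A →⋆ₐ[ℂ] B) (r : ℝ) : φ (algebraMap ℝ A r) = algebraMap ℝ B r :=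
  AlgHom.commutes (φ.toAlgHom.restrictScalars ℝ) r

theorem map_cfc_real {A : Type u} [CStarAlgebra A] {B : Type v} [CStarAlgebra B]
    (φ : A →⋆ₐ[ℂ] B) {f : ℝ → ℝ} {x : A} (hx : IsSelfAdjoint x)
    (hf : ContinuousOn f (spectrum ℝ x)) : φ (cfc f x) = cfc f (φ x) :=
  StarAlgHomClass.map_cfc (S := ℂ) φ f x hf (AddMonoidHomClass.continuous_of_bound φ 1
    (by simpa only [one_mul] using NonUnitalStarAlgHom.norm_apply_le φ)) hx (hx.map φ)

theorem norm_le_of_spectrum_subset_Icc {A : Type u} [CStarAlgebra A] {x : A}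
    (hx : IsSelfAdjoint x) {α β : ℝ} (h : spectrum ℝ x ⊆ Set.Icc α β) : ‖x‖ ≤ max |α| |β| := by
  rw [← cfc_id ℝ x hx]
  exact norm_cfc_le (by positivity) fun t ht => abs_le_max_abs_abs (h ht).1 (h ht).2

/-! ### Order intervals and functoriality of the monotone class -/

section Order

variable {A : Type u} [CStarAlgebra A] [PartialOrder A] [StarOrderedRing A]
  {B : Type v} [CStarAlgebra B] [PartialOrder B] [StarOrderedRing B]

theorem isSelfAdjoint_of_algebraMap_le {r : ℝ} {x : A} (h : algebraMap ℝ A r ≤ x) :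
    IsSelfAdjoint x := by
  have h1 : IsSelfAdjoint (x - algebraMap ℝ A r) := .of_nonneg (sub_nonneg.2 h)
  simpa using h1.add (IsSelfAdjoint.algebraMap A (IsSelfAdjoint.all r))

theorem spectrum_subset_Icc_iff {x : A} (hx : IsSelfAdjoint x) {α β : ℝ} :
    spectrum ℝ x ⊆ Set.Icc α β ↔ algebraMap ℝ A α ≤ x ∧ x ≤ algebraMap ℝ A β := by
  rw [algebraMap_le_iff_le_spectrum hx, le_algebraMap_iff_spectrum_le hx]
  exact ⟨fun h => ⟨fun t ht => (h ht).1, fun t ht => (h ht).2⟩, fun h t ht => ⟨h.1 t ht, h.2 t ht⟩⟩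

theorem spectrum_subset_Icc {x : A} {α β : ℝ} (hα : algebraMap ℝ A α ≤ x)
    (hβ : x ≤ algebraMap ℝ A β) : spectrum ℝ x ⊆ Set.Icc α β :=
  (spectrum_subset_Icc_iff (isSelfAdjoint_of_algebraMap_le hα)).2 ⟨hα, hβ⟩

theorem exists_Icc_of_isCompact {I s : Set ℝ} (hI : I.Nontrivial) (hs : IsCompact s)
    (hsI : s ⊆ I) : ∃ α ∈ I, ∃ β ∈ I, α < β ∧ s ⊆ Set.Icc α β := by
  obtain ⟨p, hp, q, hq, hpq⟩ := hI.exists_lt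
  -- Adjoining `p < q` forces `α < β` even if `s` is empty or a single point.
  have hc : IsCompact (s ∪ {p, q}) := hs.union (Set.toFinite _).isCompact
  have hne : (s ∪ {p, q}).Nonempty := ⟨p, by simp⟩
  have hsub : s ∪ {p, q} ⊆ I := by
    rintro x (hx | rfl | rfl)
    exacts [hsI hx, hp, hq]
  obtain ⟨α, hα⟩ := hc.exists_isLeast hne
  obtain ⟨β, hβ⟩ := hc.exists_isGreatest hne
  exact ⟨α, hsub hα.1, β, hsub hβ.1,
    (hα.2 (by simp : p ∈ _)).trans_lt (hpq.trans_le (hβ.2 (by simp : q ∈ _))),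
    fun x hx => ⟨hα.2 (Or.inl hx), hβ.2 (Or.inl hx)⟩⟩

/-- Membership in `P_A(I)` can be tested on pairs `α ≤ x ≤ y ≤ β` with `α < β` in `I`. -/
theorem mem_monotoneClass_iff {I : Set ℝ} (hI : I.OrdConnected) (hI' : I.Nontrivial)
    {f : ℝ → ℝ} : f ∈ monotoneClass A I ↔ ContinuousOn f I ∧
      ∀ α ∈ I, ∀ β ∈ I, α < β → ∀ x y : A, algebraMap ℝ A α ≤ x → x ≤ y → y ≤ algebraMap ℝ A β →
        cfc f x ≤ cfc f y := by
  refine ⟨fun h => ⟨h.1, fun α hα β hβ _ x y hαx hxy hyβ => ?_⟩, fun h => ⟨h.1, ?_⟩⟩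
  · exact h.2 x y (isSelfAdjoint_of_algebraMap_le hαx)
      (isSelfAdjoint_of_algebraMap_le (hαx.trans hxy))
      ((spectrum_subset_Icc hαx (hxy.trans hyβ)).trans (hI.out hα hβ))
      ((spectrum_subset_Icc (hαx.trans hxy) hyβ).trans (hI.out hα hβ)) hxy
  · intro x y hx hy hxI hyI hxy
    obtain ⟨α, hα, β, hβ, hαβ, hs⟩ := exists_Icc_of_isCompact hI'
      ((ContinuousFunctionalCalculus.isCompact_spectrum (R := ℝ) x).union
        (ContinuousFunctionalCalculus.isCompact_spectrum (R := ℝ) y)) (Set.union_subset hxI hyI)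
    exact h.2 α hα β hβ hαβ x y
      ((spectrum_subset_Icc_iff hx).1 (Set.subset_union_left.trans hs)).1 hxy
      ((spectrum_subset_Icc_iff hy).1 (Set.subset_union_right.trans hs)).2

/-- If `f` is operator monotone for `B`, then it becomes monotone on `A` after applying a
representation `A → B`. -/
theorem map_cfc_le_map_cfc (φ : A →⋆ₐ[ℂ] B) {I : Set ℝ} {f : ℝ → ℝ} (hf : f ∈ monotoneClass B I)
    {x y : A} (hx : IsSelfAdjoint x) (hy : IsSelfAdjoint y) (hxI : spectrum ℝ x ⊆ I)
    (hyI : spectrum ℝ y ⊆ I) (hxy : x ≤ y) : φ (cfc f x) ≤ φ (cfc f y) := by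
  rw [map_cfc_real φ hx (hf.1.mono hxI), map_cfc_real φ hy (hf.1.mono hyI)]
  exact hf.2 _ _ (hx.map φ) (hy.map φ) ((spectrum_real_map_subset φ x).trans hxI)
    ((spectrum_real_map_subset φ y).trans hyI) (OrderHomClass.mono φ hxy)

theorem nonneg_of_map_nonneg (φ : A →⋆ₐ[ℂ] B) (hφ : Function.Injective φ) {a : A}
    (ha : 0 ≤ φ a) : 0 ≤ a := by
  have hsa : IsSelfAdjoint a := hφ (by rw [map_star]; exact (IsSelfAdjoint.of_nonneg ha).star_eq)
  rw [StarOrderedRing.nonneg_iff_spectrum_nonneg (R := ℝ) a hsa, ← hsa.map_spectrum_real φ hφ]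
  exact (StarOrderedRing.nonneg_iff_spectrum_nonneg (R := ℝ) _ (hsa.map φ)).1 ha

theorem monotoneClass_subset_of_injective (φ : A →⋆ₐ[ℂ] B) (hφ : Function.Injective φ)
    (I : Set ℝ) : monotoneClass B I ⊆ monotoneClass A I := fun f hf =>
  ⟨hf.1, fun _ _ hx hy hxI hyI hxy => sub_nonneg.1 <| nonneg_of_map_nonneg φ hφ <| by
    rw [map_sub]
    exact sub_nonneg.2 (map_cfc_le_map_cfc φ hf hx hy hxI hyI hxy)⟩

theorem monotoneClass_congr (e : A ≃⋆ₐ[ℂ] B) (I : Set ℝ) : monotoneClass A I = monotoneClass B I :=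
  (monotoneClass_subset_of_injective (e.symm : B →⋆ₐ[ℂ] A) e.symm.injective I).antisymm
    (monotoneClass_subset_of_injective (e : A →⋆ₐ[ℂ] B) e.injective I)

/-- Used for matrices of size `0`. Order `0` enters the argument when `A` has no irreducible
representations. -/
theorem mem_monotoneClass_of_subsingleton [Subsingleton A] {I : Set ℝ} {f : ℝ → ℝ}
    (hf : ContinuousOn f I) : f ∈ monotoneClass A I :=
  ⟨hf, fun _ _ _ _ _ _ _ => (Subsingleton.elim _ _).le⟩

end Order

open scoped Matrix.Norms.L2Operator MatrixOrder in
theorem matrixMonotoneClass_eq (n : ℕ) (I : Set ℝ) : matrixMonotoneClass n I =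
    monotoneClass (EuclideanSpace ℂ (Fin n) →L[ℂ] EuclideanSpace ℂ (Fin n)) I :=
  monotoneClass_congr Matrix.toEuclideanCLM I

/-! ### Bounded strong convergence of operators -/

section StrongConvergence

variable {ι : Type*} {l : Filter ι} {H : Type u} [NormedAddCommGroup H] [InnerProductSpace ℂ H]

/-- Convergence of a bounded net in the strong operator topology. -/
structure BddStrongTendsto (a : ι → H →L[ℂ] H) (l : Filter ι) (T : H →L[ℂ] H) : Prop where
  bdd : ∃ R, ∀ i, ‖a i‖ ≤ R
  tendsto : ∀ ξ, Filter.Tendsto (fun i => a i ξ) l (nhds (T ξ))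

namespace BddStrongTendsto

theorem const (T : H →L[ℂ] H) : BddStrongTendsto (fun _ : ι => T) l T :=
  ⟨⟨‖T‖, fun _ => le_rfl⟩, fun _ => tendsto_const_nhds⟩

variable {a b : ι → H →L[ℂ] H} {S T : H →L[ℂ] H}

theorem comp {κ : Type*} {l' : Filter κ} (ha : BddStrongTendsto a l S) {φ : κ → ι}
    (hφ : Filter.Tendsto φ l' l) : BddStrongTendsto (fun i => a (φ i)) l' S :=
  ⟨ha.bdd.imp fun _ hR _ => hR _, fun ξ => (ha.tendsto ξ).comp hφ⟩

theorem add (ha : BddStrongTendsto a l S) (hb : BddStrongTendsto b l T) :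
    BddStrongTendsto (fun i => a i + b i) l (S + T) := by
  obtain ⟨R, hR⟩ := ha.bdd
  obtain ⟨R', hR'⟩ := hb.bdd
  exact ⟨⟨R + R', fun i => (norm_add_le _ _).trans (add_le_add (hR i) (hR' i))⟩,
    fun ξ => (ha.tendsto ξ).add (hb.tendsto ξ)⟩

theorem neg (ha : BddStrongTendsto a l S) : BddStrongTendsto (fun i => -a i) l (-S) := by
  obtain ⟨R, hR⟩ := ha.bdd
  exact ⟨⟨R, fun i => by simpa using hR i⟩, fun ξ => (ha.tendsto ξ).neg⟩

theorem sub (ha : BddStrongTendsto a l S) (hb : BddStrongTendsto b l T) :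
    BddStrongTendsto (fun i => a i - b i) l (S - T) := by
  simpa only [sub_eq_add_neg] using ha.add hb.neg

/-- Here the bound matters: `a i (b i ξ - T ξ)` tends to `0` because the norms `‖a i‖` are uniformly
bounded. -/
theorem mul (ha : BddStrongTendsto a l S) (hb : BddStrongTendsto b l T) :
    BddStrongTendsto (fun i => a i * b i) l (S * T) := by
  obtain ⟨R, hR⟩ := ha.bdd
  obtain ⟨R', hR'⟩ := hb.bdd
  refine ⟨⟨R * R', fun i => (norm_mul_le _ _).trans
    (mul_le_mul (hR i) (hR' i) (norm_nonneg _) ((norm_nonneg _).trans (hR i)))⟩, fun ξ => ?_⟩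
  have h1 : Filter.Tendsto (fun i => a i (b i ξ - T ξ)) l (nhds 0) := by
    have h0 : Filter.Tendsto (fun i => R * ‖b i ξ - T ξ‖) l (nhds 0) := by
      simpa using (tendsto_iff_norm_sub_tendsto_zero.1 (hb.tendsto ξ)).const_mul R
    exact squeeze_zero_norm (fun i => (a i).le_of_opNorm_le (hR i) _) h0
  simpa using h1.add (ha.tendsto (T ξ))

theorem pow (ha : BddStrongTendsto a l S) (n : ℕ) :
    BddStrongTendsto (fun i => a i ^ n) l (S ^ n) := by
  induction n with
  | zero => simpa using const (l := l) (1 : H →L[ℂ] H)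
  | succ n ih => simpa only [pow_succ] using ih.mul ha

theorem aeval (ha : BddStrongTendsto a l S) (p : Polynomial ℝ) :
    BddStrongTendsto (fun i => Polynomial.aeval (a i) p) l (Polynomial.aeval S p) := by
  induction p using Polynomial.induction_on' with
  | add p q hp hq => simpa only [map_add] using hp.add hq
  | monomial n r => simpa only [Polynomial.aeval_monomial] using (const _).mul (ha.pow n)

/-- Weierstrass approximation: polynomials pass to bounded strong limits, and a uniform
approximation of `f` on `[α, β]` is a norm approximation with an error independent of `i`. -/
theorem cfc [CompleteSpace H] {α β : ℝ} {f : ℝ → ℝ} (hf : ContinuousOn f (Set.Icc α β))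
    (ha : BddStrongTendsto a l S) (hsa : ∀ i, IsSelfAdjoint (a i)) (hS : IsSelfAdjoint S)
    (ha' : ∀ i, spectrum ℝ (a i) ⊆ Set.Icc α β) (hS' : spectrum ℝ S ⊆ Set.Icc α β) :
    BddStrongTendsto (fun i => cfc f (a i)) l (cfc f S) := by
  have key : ∀ (x : H →L[ℂ] H) (hx : IsSelfAdjoint x) (hx' : spectrum ℝ x ⊆ Set.Icc α β)
      (p : Polynomial ℝ) (δ : ℝ) (hδ : 0 < δ) (hp : ∀ t ∈ Set.Icc α β, |p.eval t - f t| < δ),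
      ‖Polynomial.aeval x p - _root_.cfc f x‖ ≤ δ := by
    intro x hx hx' p δ hδ hp
    rw [← cfc_polynomial p x hx, ← cfc_sub _ _ x p.continuousOn (hf.mono hx')]
    exact norm_cfc_le hδ.le fun t ht => (hp t (hx' ht)).le
  refine ⟨?_, fun ξ => ?_⟩
  · obtain ⟨C, hC⟩ := isCompact_Icc.exists_bound_of_continuousOn hf
    exact ⟨max C 0, fun i => norm_cfc_le (le_max_right _ _)
      fun t ht => (hC t (ha' i ht)).trans (le_max_left _ _)⟩
  · rw [Metric.tendsto_nhds]
    intro ε hε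
    -- An `ε / 3` argument at the vector `ξ`; the `+ 1` covers `ξ = 0`.
    have hδ : 0 < ε / (3 * (‖ξ‖ + 1)) := by positivity
    obtain ⟨p, hp⟩ := exists_polynomial_near_of_continuousOn α β f hf _ hδ
    have hsmall : ε / (3 * (‖ξ‖ + 1)) * ‖ξ‖ < ε / 3 := by
      rw [div_mul_eq_mul_div, div_lt_div_iff₀ (by positivity) (by norm_num)]
      nlinarith [norm_nonneg ξ]
    filter_upwards [Metric.tendsto_nhds.1 ((ha.aeval p).tendsto ξ) (ε / 3) (by positivity)]
      with i hi
    rw [dist_eq_norm] at hi ⊢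
    have h1 := ((Polynomial.aeval (a i) p - _root_.cfc f (a i)).le_of_opNorm_le
      (key _ (hsa i) (ha' i) p _ hδ hp) ξ).trans_lt hsmall
    have h2 := ((Polynomial.aeval S p - _root_.cfc f S).le_of_opNorm_le
      (key _ hS hS' p _ hδ hp) ξ).trans_lt hsmall
    rw [sub_apply] at h1 h2
    rw [norm_sub_rev] at h1
    calc ‖_root_.cfc f (a i) ξ - _root_.cfc f S ξ‖
        = ‖(_root_.cfc f (a i) ξ - Polynomial.aeval (a i) p ξ)
          + (Polynomial.aeval (a i) p ξ - Polynomial.aeval S p ξ)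
          + (Polynomial.aeval S p ξ - _root_.cfc f S ξ)‖ := by congr 1; abel
      _ ≤ _ := norm_add₃_le
      _ < ε := by linarith

/-- Inequalities between operators pass to strong limits. -/
theorem le_of_le [CompleteSpace H] [l.NeBot] (ha : BddStrongTendsto a l S)
    (hb : BddStrongTendsto b l T) (hab : ∀ i, a i ≤ b i)
    (hS : IsSelfAdjoint S) (hT : IsSelfAdjoint T) : S ≤ T := by
  rw [ContinuousLinearMap.le_def, ContinuousLinearMap.isPositive_def']
  refine ⟨hT.sub hS, fun ξ => ?_⟩
  have h1 : Filter.Tendsto (fun i => (b i - a i).reApplyInnerSelf ξ) l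
      (nhds ((T - S).reApplyInnerSelf ξ)) := by
    simp only [ContinuousLinearMap.reApplyInnerSelf_apply]
    exact (RCLike.continuous_re.tendsto _).comp (((hb.sub ha).tendsto ξ).inner tendsto_const_nhds)
  exact ge_of_tendsto' h1 fun i =>
    (ContinuousLinearMap.isPositive_def'.1 (ContinuousLinearMap.le_def _ _ |>.1 (hab i))).2 ξ

end BddStrongTendsto

end StrongConvergence

/-! ### Corners along an isometry -/

section Corner

variable {K : Type u} [NormedAddCommGroup K] [InnerProductSpace ℂ K] [CompleteSpace K]
  {H : Type v} [NormedAddCommGroup H] [InnerProductSpace ℂ H] [CompleteSpace H]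

namespace LinearIsometry

open ContinuousLinearMap

theorem adjoint_toContinuousLinearMap_apply (V : K →ₗᵢ[ℂ] H) (x : K) :
    adjoint V.toContinuousLinearMap (V x) = x := by
  refine ext_inner_right ℂ fun y => ?_
  rw [adjoint_inner_left]
  exact V.inner_map_map x y

/-- The unital representation `(X, c) ↦ V X V⋆ + c (1 - V V⋆)` defined by an isometry `V`. -/
noncomputable def cornerHom (V : K →ₗᵢ[ℂ] H) : ((K →L[ℂ] K) × ℂ) →⋆ₐ[ℂ] (H →L[ℂ] H) where
  toFun p := V.toContinuousLinearMap ∘L p.1 ∘L adjoint V.toContinuousLinearMap +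
    p.2 • (1 - V.toContinuousLinearMap ∘L adjoint V.toContinuousLinearMap)
  map_one' := by ext; simp
  map_mul' p q := by
    ext ξ
    simp [V.adjoint_toContinuousLinearMap_apply, smul_sub, mul_smul]
  map_zero' := by ext; simp
  map_add' p q := by
    ext ξ
    simp [add_smul]
    abel
  commutes' c := by
    ext ξ
    simp [Algebra.algebraMap_eq_smul_one, smul_sub]
  map_star' p := by
    simp [star_eq_adjoint, adjoint_comp]
    rfl

theorem cornerHom_apply (V : K →ₗᵢ[ℂ] H) (p : (K →L[ℂ] K) × ℂ) (ξ : H) :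
    V.cornerHom p ξ = V (p.1 (adjoint V.toContinuousLinearMap ξ)) +
      p.2 • (ξ - V (adjoint V.toContinuousLinearMap ξ)) := by
  simp [cornerHom]


/-- This is what the scalar coordinate is for: extending `X` by zero could put `0` into the
spectrum, and `0` need not lie in `I`, whereas `c` can be chosen in `I`. -/
theorem spectrum_cornerHom_subset (V : K →ₗᵢ[ℂ] H) (X : K →L[ℂ] K) (c : ℝ) :
    spectrum ℝ (V.cornerHom (X, (c : ℂ))) ⊆ spectrum ℝ X ∪ {c} := by
  refine (spectrum_real_map_subset V.cornerHom _).trans ?_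
  exact (Prod.spectrum_eq X (c : ℂ)).subset.trans
    (Set.union_subset_union_right _ (CFC.spectrum_algebraMap_subset c))

theorem isSelfAdjoint_cornerHom (V : K →ₗᵢ[ℂ] H) {X : K →L[ℂ] K} (hX : IsSelfAdjoint X) (c : ℝ) :
    IsSelfAdjoint (V.cornerHom (X, (c : ℂ))) :=
  IsSelfAdjoint.map (Prod.ext hX.star_eq (Complex.conj_ofReal c)) _

theorem cfc_cornerHom (V : K →ₗᵢ[ℂ] H) {X : K →L[ℂ] K} (hX : IsSelfAdjoint X) (c : ℝ)
    {f : ℝ → ℝ} (hf : ContinuousOn f (spectrum ℝ X ∪ {c})) :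
    cfc f (V.cornerHom (X, (c : ℂ))) = V.cornerHom (cfc f X, (f c : ℂ)) := by
  have hp : IsSelfAdjoint (X, (c : ℂ)) := Prod.ext hX.star_eq (Complex.conj_ofReal c)
  have hf' : ContinuousOn f (spectrum ℝ (X, (c : ℂ))) :=
    hf.mono ((Prod.spectrum_eq X (c : ℂ)).subset.trans
      (Set.union_subset_union_right _ (CFC.spectrum_algebraMap_subset c)))
  rw [← map_cfc_real V.cornerHom hp hf']
  congr 1
  refine Prod.ext (map_cfc_real (StarAlgHom.fst ℂ (K →L[ℂ] K) ℂ) hp hf') ?_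
  exact (map_cfc_real (StarAlgHom.snd ℂ (K →L[ℂ] K) ℂ) hp hf').trans
    (cfc_algebraMap (A := ℂ) c f)

theorem cornerHom_mono (V : K →ₗᵢ[ℂ] H) {X Y : K →L[ℂ] K} (h : X ≤ Y) (c : ℂ) :
    V.cornerHom (X, c) ≤ V.cornerHom (Y, c) := by
  rw [ContinuousLinearMap.le_def] at h ⊢
  have := h.conj_adjoint V.toContinuousLinearMap
  convert this using 1
  ext ξ
  simp [cornerHom_apply]

theorem le_of_cornerHom_le (V : K →ₗᵢ[ℂ] H) {X Y : K →L[ℂ] K} {c d : ℂ}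
    (h : V.cornerHom (X, c) ≤ V.cornerHom (Y, d)) : X ≤ Y := by
  rw [ContinuousLinearMap.le_def] at h ⊢
  have := h.adjoint_conj V.toContinuousLinearMap
  convert this using 1
  ext ξ
  simp [cornerHom_apply, V.adjoint_toContinuousLinearMap_apply]

end LinearIsometry

/-- A Hilbert space that embeds isometrically in another one has fewer operator inequalities to
satisfy. -/
theorem LinearIsometry.monotoneClass_subset (V : K →ₗᵢ[ℂ] H) {I : Set ℝ} (hI : I.Nonempty) :
    monotoneClass (H →L[ℂ] H) I ⊆ monotoneClass (K →L[ℂ] K) I := by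
  obtain ⟨c, hc⟩ := hI
  refine fun f hf => ⟨hf.1, fun X Y hX hY hXI hYI hXY =>
    V.le_of_cornerHom_le (c := f c) (d := f c) ?_⟩
  have hXc : spectrum ℝ X ∪ {c} ⊆ I := Set.union_subset hXI (by simpa using hc)
  have hYc : spectrum ℝ Y ∪ {c} ⊆ I := Set.union_subset hYI (by simpa using hc)
  rw [← V.cfc_cornerHom hX c (hf.1.mono hXc), ← V.cfc_cornerHom hY c (hf.1.mono hYc)]
  exact hf.2 _ _ (V.isSelfAdjoint_cornerHom hX c) (V.isSelfAdjoint_cornerHom hY c)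
    ((V.spectrum_cornerHom_subset X c).trans hXc) ((V.spectrum_cornerHom_subset Y c).trans hYc)
    (V.cornerHom_mono hXY c)

end Corner

/-! ### Comparison of Hilbert spaces by dimension -/

section FiniteDimensional

variable {H : Type v} [NormedAddCommGroup H] [InnerProductSpace ℂ H] [CompleteSpace H]

/-- The standard class of operator functions of order `n`, on the Hilbert space `ℂⁿ`. -/
abbrev euclideanMonotoneClass (n : ℕ) (I : Set ℝ) : Set (ℝ → ℝ) :=
  monotoneClass (EuclideanSpace ℂ (Fin n) →L[ℂ] EuclideanSpace ℂ (Fin n)) I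

theorem exists_linearIsometry_of_finrank_le {H : Type v} [NormedAddCommGroup H]
    [InnerProductSpace ℂ H] {n : ℕ} [FiniteDimensional ℂ H]
    (h : Module.finrank ℂ H ≤ n) : Nonempty (H →ₗᵢ[ℂ] EuclideanSpace ℂ (Fin n)) := by
  let b := stdOrthonormalBasis ℂ H
  let w : Fin (Module.finrank ℂ H) → EuclideanSpace ℂ (Fin n) :=
    fun i => EuclideanSpace.basisFun (Fin n) ℂ (Fin.castLE h i)
  have hw : Orthonormal ℂ w :=
    (EuclideanSpace.basisFun (Fin n) ℂ).orthonormal.comp _ (Fin.castLE_injective h)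
  exact ⟨(b.toBasis.constr ℂ w).isometryOfOrthonormal (v := b.toBasis) (by simp [b.orthonormal])
    (by rwa [show b.toBasis.constr ℂ w ∘ b.toBasis = w from
      funext (b.toBasis.constr_basis ℂ w)])⟩

theorem exists_linearIsometry_of_le_finrank {H : Type v} [NormedAddCommGroup H]
    [InnerProductSpace ℂ H] {n : ℕ} [FiniteDimensional ℂ H]
    (h : n ≤ Module.finrank ℂ H) : Nonempty (EuclideanSpace ℂ (Fin n) →ₗᵢ[ℂ] H) := by
  let b := (EuclideanSpace.basisFun (Fin n) ℂ)
  let w : Fin n → H := fun i => stdOrthonormalBasis ℂ H (Fin.castLE h i)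
  have hw : Orthonormal ℂ w :=
    (stdOrthonormalBasis ℂ H).orthonormal.comp _ (Fin.castLE_injective h)
  exact ⟨(b.toBasis.constr ℂ w).isometryOfOrthonormal (v := b.toBasis) (by simp [b.orthonormal])
    (by rwa [show b.toBasis.constr ℂ w ∘ b.toBasis = w from
      funext (b.toBasis.constr_basis ℂ w)])⟩

theorem exists_linearIsometry_of_infinite {H : Type v} [NormedAddCommGroup H]
    [InnerProductSpace ℂ H] (h : ¬ FiniteDimensional ℂ H) (n : ℕ) :
    Nonempty (EuclideanSpace ℂ (Fin n) →ₗᵢ[ℂ] H) := by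
  obtain ⟨f, hf⟩ := exists_linearIndependent_of_le_rank (R := ℂ) (M := H) (n := n)
    ((Cardinal.natCast_lt_aleph0 (n := n)).le.trans (by rwa [← not_lt, Module.rank_lt_aleph0_iff]))
  let W := Submodule.span ℂ (Set.range f)
  have : FiniteDimensional ℂ W := FiniteDimensional.span_of_finite ℂ (Set.finite_range f)
  obtain ⟨V⟩ := exists_linearIsometry_of_le_finrank (H := W) (n := n)
    (by rw [finrank_span_eq_card hf]; simp)
  exact ⟨W.subtypeₗᵢ.comp V⟩

namespace LinearIsometry

variable {K : Type u} [NormedAddCommGroup K] [InnerProductSpace ℂ K] [CompleteSpace K]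

/-- The compression `V⋆ x V` of an operator along an isometry. -/
noncomputable def compression (V : K →ₗᵢ[ℂ] H) (x : H →L[ℂ] H) : K →L[ℂ] K :=
  ContinuousLinearMap.adjoint V.toContinuousLinearMap ∘L x ∘L V.toContinuousLinearMap

theorem compression_mono (V : K →ₗᵢ[ℂ] H) {x y : H →L[ℂ] H} (h : x ≤ y) :
    V.compression x ≤ V.compression y := by
  rw [ContinuousLinearMap.le_def] at h ⊢
  convert h.adjoint_conj V.toContinuousLinearMap using 1
  ext ξ
  simp [compression]

theorem compression_algebraMap (V : K →ₗᵢ[ℂ] H) (r : ℝ) :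
    V.compression (algebraMap ℝ _ r) = algebraMap ℝ _ r := by
  ext ξ
  have h (η : H) : algebraMap ℝ (H →L[ℂ] H) r η = (r : ℂ) • η := rfl
  have h' (η : K) : algebraMap ℝ (K →L[ℂ] K) r η = (r : ℂ) • η := rfl
  simp only [compression, ContinuousLinearMap.comp_apply, h, h', map_smul,
    LinearIsometry.coe_toContinuousLinearMap]
  rw [V.adjoint_toContinuousLinearMap_apply]

theorem algebraMap_le_compression (V : K →ₗᵢ[ℂ] H) {x : H →L[ℂ] H} {r : ℝ}
    (h : algebraMap ℝ _ r ≤ x) : algebraMap ℝ _ r ≤ V.compression x := by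
  simpa only [compression_algebraMap] using V.compression_mono h

theorem compression_le_algebraMap (V : K →ₗᵢ[ℂ] H) {x : H →L[ℂ] H} {r : ℝ}
    (h : x ≤ algebraMap ℝ _ r) : V.compression x ≤ algebraMap ℝ _ r := by
  simpa only [compression_algebraMap] using V.compression_mono h

end LinearIsometry

/-- The inclusion in `H` of the span of a finite set. -/
noncomputable abbrev finsetInclusion (F : Finset H) : Submodule.span ℂ (F : Set H) →ₗᵢ[ℂ] H :=
  (Submodule.span ℂ (F : Set H)).subtypeₗᵢ

theorem finsetInclusion_adjoint_apply {F : Finset H} {ξ : H} (h : ξ ∈ F) :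
    finsetInclusion F (ContinuousLinearMap.adjoint (finsetInclusion F).toContinuousLinearMap ξ) =
      ξ := by
  have := (finsetInclusion F).adjoint_toContinuousLinearMap_apply
    ⟨ξ, Submodule.subset_span (by simpa using h)⟩
  exact congrArg Subtype.val this

/-- Every bounded operator is a strong limit of corners on finite-dimensional subspaces. -/
theorem bddStrongTendsto_cornerHom {x : H →L[ℂ] H} {α β : ℝ} (hαβ : α ≤ β)
    (h1 : algebraMap ℝ _ α ≤ x) (h2 : x ≤ algebraMap ℝ _ β) :
    BddStrongTendsto (fun F : Finset H =>
      (finsetInclusion F).cornerHom ((finsetInclusion F).compression x, (α : ℂ)))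
      Filter.atTop x := by
  classical
  refine ⟨⟨max |α| |β|, fun F => norm_le_of_spectrum_subset_Icc
    ((finsetInclusion F).isSelfAdjoint_cornerHom (isSelfAdjoint_of_algebraMap_le
      ((finsetInclusion F).algebraMap_le_compression h1)) α)
    (((finsetInclusion F).spectrum_cornerHom_subset _ α).trans (Set.union_subset
      (spectrum_subset_Icc ((finsetInclusion F).algebraMap_le_compression h1)
        ((finsetInclusion F).compression_le_algebraMap h2)) (by simpa using hαβ)))⟩, fun ξ => ?_⟩
  refine tendsto_const_nhds.congr' ?_
  -- Once `F` contains both `ξ` and `x ξ`, the corner agrees with `x` at `ξ`, so the net is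
  -- eventually constant there.
  filter_upwards [Filter.eventually_ge_atTop {ξ, x ξ}] with F hF
  have hξ : ξ ∈ F := hF (by simp)
  have hxξ : x ξ ∈ F := hF (by simp)
  rw [LinearIsometry.cornerHom_apply, finsetInclusion_adjoint_apply hξ, sub_self, smul_zero,
    add_zero, LinearIsometry.compression, ContinuousLinearMap.comp_apply,
    ContinuousLinearMap.comp_apply, LinearIsometry.coe_toContinuousLinearMap,
    finsetInclusion_adjoint_apply hξ, finsetInclusion_adjoint_apply hxξ]

/-- Functions that are matrix monotone of all orders are operator monotone. -/
theorem mem_monotoneClass_of_forall_euclidean {I : Set ℝ} (hI : I.OrdConnected)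
    (hI' : I.Nontrivial) {f : ℝ → ℝ} (hf : ∀ n, 1 ≤ n → f ∈ euclideanMonotoneClass n I) :
    f ∈ monotoneClass (H →L[ℂ] H) I := by
  have hfc := (hf 1 le_rfl).1
  refine (mem_monotoneClass_iff hI hI').2 ⟨hfc, fun α hα β hβ hαβ x y hαx hxy hyβ => ?_⟩
  have hsub : Set.Icc α β ⊆ I := hI.out hα hβ
  have hαu : {α} ⊆ Set.Icc α β := by simpa using hαβ.le
  have hlimf : ∀ {x : H →L[ℂ] H}, algebraMap ℝ _ α ≤ x → x ≤ algebraMap ℝ _ β →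
      BddStrongTendsto (fun F : Finset H => (finsetInclusion F).cornerHom
        (cfc f ((finsetInclusion F).compression x), (f α : ℂ))) Filter.atTop (cfc f x) := by
    intro x h1 h2
    have hsa (F : Finset H) : IsSelfAdjoint ((finsetInclusion F).compression x) :=
      isSelfAdjoint_of_algebraMap_le ((finsetInclusion F).algebraMap_le_compression h1)
    have hsp (F : Finset H) : spectrum ℝ ((finsetInclusion F).compression x) ⊆ Set.Icc α β :=
      spectrum_subset_Icc ((finsetInclusion F).algebraMap_le_compression h1)
        ((finsetInclusion F).compression_le_algebraMap h2)
    have := (bddStrongTendsto_cornerHom hαβ.le h1 h2).cfc (hfc.mono hsub)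
      (fun F => (finsetInclusion F).isSelfAdjoint_cornerHom (hsa F) α)
      (isSelfAdjoint_of_algebraMap_le h1)
      (fun F => ((finsetInclusion F).spectrum_cornerHom_subset _ α).trans
        (Set.union_subset (hsp F) hαu)) (spectrum_subset_Icc h1 h2)
    convert this using 2 with F
    exact ((finsetInclusion F).cfc_cornerHom (hsa F) α
      (hfc.mono ((Set.union_subset (hsp F) hαu).trans hsub))).symm
  refine (hlimf hαx (hxy.trans hyβ)).le_of_le (hlimf (hαx.trans hxy) hyβ) (fun F => ?_)
    IsSelfAdjoint.cfc IsSelfAdjoint.cfc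
  -- The order is the dimension plus one, so that it is at least `1` even when the span is zero.
  have hfF : f ∈ monotoneClass (Submodule.span ℂ (F : Set H) →L[ℂ] _) I :=
    (exists_linearIsometry_of_finrank_le
      (n := Module.finrank ℂ (Submodule.span ℂ (F : Set H)) + 1)
      (Nat.le_succ _)).some.monotoneClass_subset hI'.nonempty (hf _ (by omega))
  exact (finsetInclusion F).cornerHom_mono (((mem_monotoneClass_iff hI hI').1 hfF).2 α hα β hβ hαβ
    _ _ ((finsetInclusion F).algebraMap_le_compression hαx)
    ((finsetInclusion F).compression_mono hxy)
    ((finsetInclusion F).compression_le_algebraMap hyβ)) _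

end FiniteDimensional

/-! ### Schur's lemma and density of irreducible representations -/

section Irreducible

open ComplexStarModule Filter Topology

variable {A : Type u} [CStarAlgebra A] {H : Type v} [NormedAddCommGroup H]
  [InnerProductSpace ℂ H] [CompleteSpace H] {π : A →⋆ₐ[ℂ] (H →L[ℂ] H)}

namespace IsIrreducibleRep

/-- If the spectrum had two points, two bump functions with product zero would give nonzero `f(S)`
and `g(S)` with `f(S) g(S) = 0`. Then the kernel of `f(S)` is closed and invariant, is not `H`, and
contains the range of `g(S)`, so it is not `0`. -/
theorem eq_algebraMap_of_isSelfAdjoint (hπ : IsIrreducibleRep π) {S : H →L[ℂ] H}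
    (hS : IsSelfAdjoint S) (hcomm : ∀ a, Commute (π a) S) : ∃ c : ℝ, S = algebraMap ℝ _ c := by
  have := hπ.1
  obtain ⟨s, hs⟩ := ContinuousFunctionalCalculus.spectrum_nonempty (R := ℝ) S hS
  refine ⟨s, CFC.eq_algebraMap_of_spectrum_subset_singleton S s ?_ hS⟩
  by_contra hsub
  obtain ⟨t, ht, hts⟩ := Set.not_subset.1 hsub
  have hts : t ≠ s := hts
  -- two bump functions with product zero, non-zero at `s` and `t` respectively
  have hd : 0 < |t - s| / 2 := by have := abs_pos.2 (sub_ne_zero.2 hts); positivity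
  let f : ℝ → ℝ := fun x => max (|t - s| / 2 - |x - s|) 0
  let g : ℝ → ℝ := fun x => max (|t - s| / 2 - |x - t|) 0
  have hf : Continuous f := by fun_prop
  have hg : Continuous g := by fun_prop
  have hne : ∀ {h : ℝ → ℝ} {x : ℝ}, Continuous h → x ∈ spectrum ℝ S → h x ≠ 0 → cfc h S ≠ 0 := by
    intro h x hh hx hx0 h0
    rw [← cfc_zero ℝ S, cfc_eq_cfc_iff_eqOn] at h0
    exact hx0 (h0 hx)
  have hfS : cfc f S ≠ 0 := hne hf hs (by simp [f, hd])
  have hgS : cfc g S ≠ 0 := hne hg ht (by simp [g, hd])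
  have hfg : cfc f S * cfc g S = 0 := by
    rw [← cfc_mul f g S, ← cfc_zero ℝ S]
    refine cfc_congr fun x _ => ?_
    simp only [f, g, Pi.zero_apply, mul_eq_zero, max_eq_right_iff, sub_nonpos]
    by_contra! h
    have := abs_sub_le t x s
    rw [abs_sub_comm t x] at this
    linarith
  have hclosed : IsClosed ((cfc f S).ker : Set H) := (cfc f S).isClosed_ker
  rcases hπ.2 (cfc f S).ker hclosed (fun a ξ hξ => by
    have hc : Commute (cfc f S) (π a) := hS.commute_cfc (hcomm a).symm f
    rw [LinearMap.mem_ker] at hξ ⊢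
    have := congrArg (fun T : H →L[ℂ] H => T ξ) hc.eq
    exact this.trans (by simpa using congrArg (π a) hξ)) with h | h
  · refine hgS (ContinuousLinearMap.ext fun ξ => ?_)
    have : cfc g S ξ ∈ (cfc f S).ker := by
      rw [LinearMap.mem_ker]
      exact congrArg (fun T : H →L[ℂ] H => T ξ) hfg
    rw [h] at this
    simpa using this
  · refine hfS (ContinuousLinearMap.ext fun ξ => ?_)
    have : ξ ∈ (cfc f S).ker := h ▸ Submodule.mem_top
    simpa using this

/-- **Schur's lemma**: the commutant of an irreducible representation is trivial. -/
theorem eq_smul_one_of_commute (hπ : IsIrreducibleRep π) {S : H →L[ℂ] H}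
    (hcomm : ∀ a, Commute (π a) S) : ∃ c : ℂ, S = c • 1 := by
  have hstar : ∀ a, Commute (π a) (star S) := fun a => by
    have := (hcomm (star a)).star_star
    rwa [map_star, star_star] at this
  have hre : ∀ a, Commute (π a) (ℜ S : H →L[ℂ] H) := fun a => by
    rw [realPart_apply_coe]
    exact ((hcomm a).add_right (hstar a)).smul_right _
  have him : ∀ a, Commute (π a) (ℑ S : H →L[ℂ] H) := fun a => by
    rw [imaginaryPart_apply_coe]
    exact (((hcomm a).sub_right (hstar a)).smul_right _).smul_right _
  obtain ⟨c, hc⟩ := hπ.eq_algebraMap_of_isSelfAdjoint (ℜ S).2 hre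
  obtain ⟨d, hd⟩ := hπ.eq_algebraMap_of_isSelfAdjoint (ℑ S).2 him
  refine ⟨c + Complex.I * d, ?_⟩
  rw [← realPart_add_I_smul_imaginaryPart S, hc, hd, add_smul, mul_smul]
  rfl

/-- The image of an irreducible representation is strongly dense in `B(H)`. -/
theorem mem_closure_range (hπ : IsIrreducibleRep π) {ι : Type*} [Fintype ι] (T : H →L[ℂ] H)
    (ξ : ι → H) : (fun i => T (ξ i)) ∈ closure (Set.range fun a i => π a (ξ i)) := by
  classical
  -- Amplification: the tuple `ξ` becomes one vector `x₀` of `E`, on which operators act diagonally.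
  -- The projection onto the closed orbit `W` of `x₀` commutes with all `D (π a)`; the task is to
  -- make it commute with `D T`.
  let E := PiLp 2 (fun _ : ι => H)
  let D : (H →L[ℂ] H) → E →L[ℂ] E := fun T =>
    (PiLp.continuousLinearEquiv 2 ℂ (fun _ : ι => H)).symm.toContinuousLinearMap ∘L
      (ContinuousLinearMap.piMap fun _ => T) ∘L
      (PiLp.continuousLinearEquiv 2 ℂ (fun _ : ι => H)).toContinuousLinearMap
  have hD : ∀ T v i, D T v i = T (v i) := fun T v i => rfl
  let ι' : ι → H →L[ℂ] E := fun j =>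
    (PiLp.continuousLinearEquiv 2 ℂ (fun _ : ι => H)).symm.toContinuousLinearMap ∘L
      ContinuousLinearMap.single ℂ (fun _ : ι => H) j
  have hι : ∀ j x i, ι' j x i = if i = j then x else 0 := fun j x i => by
    change (Pi.single j x : ι → H) i = _
    rw [Pi.single_apply]
  have hDι : ∀ T j x, D T (ι' j x) = ι' j (T x) := fun T j x => by
    ext i
    rw [hD, hι, hι]
    split_ifs <;> simp
  have hsum : ∀ v : E, ∑ j, ι' j (v j) = v := fun v => by
    ext i
    rw [WithLp.ofLp_sum, Finset.sum_apply]
    simp [hι]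
  let x₀ : E := WithLp.toLp 2 ξ
  let L : A →ₗ[ℂ] E :=
    { toFun := fun a => D (π a) x₀
      map_add' := fun a b => by
        ext i
        change π (a + b) (x₀ i) = π a (x₀ i) + π b (x₀ i)
        simp
      map_smul' := fun c a => by
        ext i
        change π (c • a) (x₀ i) = c • π a (x₀ i)
        simp }
  let W : Submodule ℂ E := (LinearMap.range L).topologicalClosure
  have hWc : IsClosed (W : Set E) := Submodule.isClosed_topologicalClosure _
  have : CompleteSpace W := hWc.completeSpace_coe
  have hWinv : ∀ a, ∀ v ∈ W, D (π a) v ∈ W := by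
    intro a
    have hmaps : Set.MapsTo (D (π a)) (LinearMap.range L : Set E) (LinearMap.range L) := by
      rintro _ ⟨b, rfl⟩
      refine ⟨a * b, ?_⟩
      ext i
      simp [L, hD]
    exact hmaps.closure (D (π a)).continuous
  have hadj : ∀ a v w, inner ℂ (D (π a) v) w = inner ℂ v (D (π (star a)) w) := by
    intro a v w
    rw [PiLp.inner_apply, PiLp.inner_apply]
    refine Finset.sum_congr rfl fun i _ => ?_
    rw [hD, hD, map_star, ContinuousLinearMap.star_eq_adjoint,
      ContinuousLinearMap.adjoint_inner_right]
  have hPD : ∀ a v, W.starProjection (D (π a) v) = D (π a) (W.starProjection v) := by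
    intro a v
    refine (Submodule.eq_starProjection_of_mem_of_inner_eq_zero
      (hWinv a _ (Submodule.starProjection_apply_mem _ _)) fun w hw => ?_)
    rw [← map_sub, hadj]
    exact Submodule.starProjection_inner_eq_zero v _ (hWinv _ w hw)
  -- The matrix entries of the projection commute with `π`, so Schur's lemma makes them scalars, and
  -- a matrix of scalars commutes with `D T`.
  let P : ι → ι → H →L[ℂ] H := fun i j =>
    (PiLp.proj 2 (fun _ : ι => H) i : E →L[ℂ] H) ∘L W.starProjection ∘L ι' j
  have hP : ∀ i j x, P i j x = W.starProjection (ι' j x) i := fun i j x => rfl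
  have hPc : ∀ i j, ∃ c : ℂ, P i j = c • 1 := fun i j =>
    hπ.eq_smul_one_of_commute fun a => by
      ext x
      change π a (P i j x) = P i j (π a x)
      rw [hP, hP, ← hDι, hPD, hD]
  have hPT : ∀ v, W.starProjection (D T v) = D T (W.starProjection v) := by
    intro v
    rw [← hsum v]
    simp only [map_sum, hDι]
    refine Finset.sum_congr rfl fun j _ => ?_
    ext i
    rw [hD, ← hP, ← hP]
    obtain ⟨c, hc⟩ := hPc i j
    simp [hc]
  have hx₀ : x₀ ∈ W := Submodule.le_topologicalClosure _ ⟨1, by ext i; simp [L, hD]⟩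
  have hTx : D T x₀ ∈ W := by
    rw [← Submodule.starProjection_eq_self_iff.2 hx₀, ← hPT]
    exact Submodule.starProjection_apply_mem _ _
  have hcont : Continuous fun v : E => fun i => v i := PiLp.continuous_ofLp 2 _
  have := map_mem_closure hcont (show D T x₀ ∈ closure (LinearMap.range L : Set E) from hTx)
    (t := Set.range fun a i => π a (ξ i)) (by rintro _ ⟨a, rfl⟩; exact ⟨a, rfl⟩)
  exact this

/-- The self-adjoint part of the image of an irreducible representation is strongly dense in the
self-adjoint operators. -/
theorem mem_closure_range_selfAdjoint (hπ : IsIrreducibleRep π) {ι : Type*} [Fintype ι]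
    {T : H →L[ℂ] H} (hT : IsSelfAdjoint T) (ξ : ι → H) :
    (fun i => T (ξ i)) ∈ closure (Set.range fun (a : selfAdjoint A) i => π a (ξ i)) := by
  classical
  by_contra hmem
  let L : selfAdjoint A →ₗ[ℝ] (ι → H) :=
    { toFun := fun a i => π a (ξ i)
      map_add' := fun a b => by ext i; simp
      map_smul' := fun c a => by
        ext i
        have h : ((c • a : selfAdjoint A) : A) = (c : ℂ) • (a : A) := rfl
        simp only [h, map_smul]
        rfl }
  obtain ⟨f, u, hfu, huT⟩ := RCLike.geometric_hahn_banach_closed_point (𝕜 := ℂ)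
    (s := closure (LinearMap.range L : Set (ι → H))) (LinearMap.range L).convex.closure
    isClosed_closure hmem
  -- The real part of `f` is bounded above on a real subspace, hence vanishes on it.
  have hzero : ∀ a, (f (L a)).re = 0 := by
    intro a
    by_contra hne
    have h1 := hfu _ (subset_closure ⟨(u / (f (L a)).re) • a, rfl⟩)
    have h2 : f (((u / (f (L a)).re : ℝ) : ℂ) • L a) = ((u / (f (L a)).re : ℝ) : ℂ) * f (L a) := by
      rw [map_smul, smul_eq_mul]
    have h3 : L ((u / (f (L a)).re) • a) = ((u / (f (L a)).re : ℝ) : ℂ) • L a := map_smul L _ a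
    rw [h3, h2] at h1
    simp [div_mul_cancel₀ _ hne] at h1
  have hu : 0 < u := by simpa using hfu _ (subset_closure (LinearMap.range L).zero_mem)
  -- represent the coordinates of `f` by vectors
  let η : ι → H := fun i => (InnerProductSpace.toDual ℂ H).symm
    (f ∘L ContinuousLinearMap.single ℂ (fun _ : ι => H) i)
  have hη : ∀ v : ι → H, f v = ∑ i, inner ℂ (η i) (v i) := by
    intro v
    simp only [η, InnerProductSpace.toDual_symm_apply]
    conv_lhs => rw [← Finset.univ_sum_single v, map_sum]
    rfl
  -- For self-adjoint `S`, twice the real part of `f (S ξ)` equals `∑ ⟪η i, S (ξ i)⟫ + ⟪ξ i, S (η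
  -- i)⟫`, which is complex linear in `S`. It therefore vanishes on all of `π(A)`, and the density
  -- already proved, applied to the doubled tuple `(ξ, η)`, makes it vanish at `T`.
  let ψ : (ι ⊕ ι → H) → ℂ := fun v =>
    ∑ i, (inner ℂ (η i) (v (Sum.inl i)) + inner ℂ (ξ i) (v (Sum.inr i)))
  let ζ : ι ⊕ ι → H := Sum.elim ξ η
  have hψ : Continuous ψ := by fun_prop
  have hsa : ∀ S : H →L[ℂ] H, IsSelfAdjoint S →
      ψ (fun i => S (ζ i)) = 2 * ((f fun i => S (ξ i)).re : ℂ) := by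
    intro S hS
    have hterm : ∀ i, inner ℂ (ξ i) (S (η i)) = (starRingEnd ℂ) (inner ℂ (η i) (S (ξ i))) := by
      intro i
      rw [inner_conj_symm, ← ContinuousLinearMap.adjoint_inner_left]
      rw [← ContinuousLinearMap.star_eq_adjoint, hS.star_eq]
    simp only [ψ, ζ, Sum.elim_inl, Sum.elim_inr, hterm, Finset.sum_add_distrib]
    rw [← map_sum, ← hη (fun i => S (ξ i)), Complex.add_conj]
    push_cast
    rfl
  have hψA : ∀ a : A, ψ (fun i => π a (ζ i)) = 0 := by
    intro a
    have hsa0 : ∀ a : selfAdjoint A, ψ (fun i => π a (ζ i)) = 0 := fun a => by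
      rw [hsa _ (a.2.map π)]
      simp [show (f fun i => π a (ξ i)).re = 0 from hzero a]
    have hlin : ∀ (x y : A) (c : ℂ), ψ (fun i => π (x + c • y) (ζ i)) =
        ψ (fun i => π x (ζ i)) + c * ψ (fun i => π y (ζ i)) := by
      intro x y c
      simp only [ψ, map_add, map_smul, add_apply, smul_apply, inner_add_right, inner_smul_right,
        Finset.mul_sum, ← Finset.sum_add_distrib]
      refine Finset.sum_congr rfl fun i _ => by ring
    rw [← realPart_add_I_smul_imaginaryPart a, hlin, hsa0, hsa0]
    simp
  have hψT : ψ (fun i => T (ζ i)) = 0 := by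
    have hcl : closure (Set.range fun a i => π a (ζ i)) ⊆ ψ ⁻¹' {0} :=
      closure_minimal (by rintro _ ⟨a, rfl⟩; exact hψA a) (isClosed_singleton.preimage hψ)
    exact hcl (hπ.mem_closure_range T ζ)
  rw [hsa T hT] at hψT
  have : (f fun i => T (ξ i)).re = 0 := by simpa using hψT
  have h3 : u < (f fun i => T (ξ i)).re := huT
  linarith

end IsIrreducibleRep

end Irreducible

/-! ### Kaplansky density, also for ordered pairs -/

section Kaplansky

open Filter Topology

/-- The function `t ↦ (1 + t²)⁻¹`, whose functional calculus is strongly continuous without any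
boundedness assumption. -/
noncomputable def invOneAddSq (t : ℝ) : ℝ := (1 + t ^ 2)⁻¹

theorem continuous_invOneAddSq : Continuous invOneAddSq :=
  Continuous.inv₀ (by fun_prop) fun t => by positivity

theorem invOneAddSq_mem_Icc (t : ℝ) : invOneAddSq t ∈ Set.Icc 0 1 :=
  ⟨by unfold invOneAddSq; positivity, inv_le_one_of_one_le₀ (by nlinarith [sq_nonneg t])⟩

section

variable {B : Type v} [CStarAlgebra B] {x : B}

theorem cfc_invOneAddSq_mul (hx : IsSelfAdjoint x) : cfc invOneAddSq x * (1 + x ^ 2) = 1 := by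
  have h : cfc (fun t : ℝ => 1 + t ^ 2) x = 1 + x ^ 2 := by
    rw [cfc_const_add 1 (fun t => t ^ 2) x, cfc_pow_id x 2, map_one]
  rw [← h, ← cfc_mul _ _ x continuous_invOneAddSq.continuousOn, ← cfc_const_one ℝ x]
  exact cfc_congr fun t _ => inv_mul_cancel₀ (by positivity)

theorem mul_cfc_invOneAddSq (hx : IsSelfAdjoint x) : (1 + x ^ 2) * cfc invOneAddSq x = 1 := by
  have h : cfc (fun t : ℝ => 1 + t ^ 2) x = 1 + x ^ 2 := by
    rw [cfc_const_add 1 (fun t => t ^ 2) x, cfc_pow_id x 2, map_one]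
  have hc := cfc_commute_cfc (fun t : ℝ => 1 + t ^ 2) invOneAddSq x
  rw [h] at hc
  exact hc.eq.trans (cfc_invOneAddSq_mul hx)

theorem norm_cfc_invOneAddSq_le : ‖cfc invOneAddSq x‖ ≤ 1 :=
  norm_cfc_le zero_le_one fun t _ => by
    rw [Real.norm_of_nonneg (invOneAddSq_mem_Icc t).1]
    exact (invOneAddSq_mem_Icc t).2

theorem norm_cfc_invOneAddSq_mul_self_le (hx : IsSelfAdjoint x) :
    ‖cfc invOneAddSq x * x‖ ≤ 1 := by
  have hmul : cfc invOneAddSq x * x = cfc (fun t => invOneAddSq t * t) x := by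
    rw [cfc_mul _ _ x continuous_invOneAddSq.continuousOn, cfc_id' ℝ x]
  rw [hmul]
  refine norm_cfc_le zero_le_one fun t _ => ?_
  have h : (0 : ℝ) < 1 + t ^ 2 := by positivity
  rw [invOneAddSq, norm_mul, norm_inv, Real.norm_of_nonneg h.le, inv_mul_le_one₀ h,
    Real.norm_eq_abs]
  nlinarith [sq_abs t, sq_nonneg (|t| - 1)]

/-- From `y² - x² = (y - x) y + x (y - x)`. The factors to the left of `y - x` have norm at most `1`
whatever the norm of `x`, and those to the right depend on `y` only; this gives strong continuity
along unbounded nets. -/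
theorem cfc_invOneAddSq_sub {y : B} (hx : IsSelfAdjoint x) (hy : IsSelfAdjoint y) :
    cfc invOneAddSq x - cfc invOneAddSq y =
      cfc invOneAddSq x * ((y - x) * (y * cfc invOneAddSq y)) +
        cfc invOneAddSq x * x * ((y - x) * cfc invOneAddSq y) := by
  calc cfc invOneAddSq x - cfc invOneAddSq y
      = cfc invOneAddSq x * ((1 + y ^ 2) * cfc invOneAddSq y) -
        cfc invOneAddSq x * (1 + x ^ 2) * cfc invOneAddSq y := by
          rw [mul_cfc_invOneAddSq hy, cfc_invOneAddSq_mul hx, mul_one, one_mul]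
    _ = _ := by noncomm_ring

end

variable {H : Type v} [NormedAddCommGroup H] [InnerProductSpace ℂ H] [CompleteSpace H]

theorem bddStrongTendsto_invOneAddSq {ι : Type*} {l : Filter ι} {a : ι → H →L[ℂ] H}
    {S : H →L[ℂ] H} (ha : ∀ i, IsSelfAdjoint (a i)) (hS : IsSelfAdjoint S)
    (h : ∀ ξ, Tendsto (fun i => a i ξ) l (𝓝 (S ξ))) :
    BddStrongTendsto (fun i => cfc invOneAddSq (a i)) l (cfc invOneAddSq S) := by
  refine ⟨⟨1, fun i => norm_cfc_invOneAddSq_le⟩, fun ξ => ?_⟩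
  have h0 : ∀ η, Tendsto (fun i => ‖(S - a i) η‖) l (𝓝 0) := fun η => by
    simpa [norm_sub_rev] using tendsto_iff_norm_sub_tendsto_zero.1 (h η)
  rw [tendsto_iff_norm_sub_tendsto_zero]
  refine squeeze_zero (fun _ => norm_nonneg _) (fun i => ?_)
    (by simpa using (h0 (S (cfc invOneAddSq S ξ))).add (h0 (cfc invOneAddSq S ξ)))
  have : cfc invOneAddSq (a i) ξ - cfc invOneAddSq S ξ =
      cfc invOneAddSq (a i) ((S - a i) (S (cfc invOneAddSq S ξ))) +
        (cfc invOneAddSq (a i) * a i) ((S - a i) (cfc invOneAddSq S ξ)) :=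
    congrArg (fun T : H →L[ℂ] H => T ξ) (cfc_invOneAddSq_sub (ha i) hS)
  rw [this]
  refine (norm_add_le _ _).trans (add_le_add ?_ ?_)
  · exact (ContinuousLinearMap.le_of_opNorm_le _ norm_cfc_invOneAddSq_le _).trans (one_mul _).le
  · exact (ContinuousLinearMap.le_of_opNorm_le _
      (norm_cfc_invOneAddSq_mul_self_le (ha i)) _).trans (one_mul _).le

variable {A : Type u} [CStarAlgebra A] {π : A →⋆ₐ[ℂ] (H →L[ℂ] H)}

/-- Density on finite tuples is density for pointwise convergence of maps `H → H`; the filter is the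
pullback of the neighbourhoods of `S`. No norm bound is obtained at this stage. -/
theorem IsIrreducibleRep.exists_tendsto_selfAdjoint (hπ : IsIrreducibleRep π) {S : H →L[ℂ] H}
    (hS : IsSelfAdjoint S) : ∃ l : Filter (selfAdjoint A), l.NeBot ∧
      ∀ ξ, Tendsto (fun a : selfAdjoint A => π a ξ) l (𝓝 (S ξ)) := by
  have hmem : (S : H → H) ∈ closure (Set.range fun (a : selfAdjoint A) ξ => π a ξ) := by
    rw [mem_closure_iff]
    intro o ho hSo
    obtain ⟨F, U, hU, hsub⟩ := isOpen_pi_iff.1 ho _ hSo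
    have hmem := hπ.mem_closure_range_selfAdjoint hS (fun i : F => (i : H))
    obtain ⟨_, hin, a, rfl⟩ := mem_closure_iff.1 hmem (Set.univ.pi fun i : F => U i)
      (isOpen_set_pi Set.finite_univ fun i _ => (hU i i.2).1) fun i _ => (hU i i.2).2
    exact ⟨_, hsub fun ξ hξ => hin ⟨ξ, hξ⟩ trivial, a, rfl⟩
  refine ⟨comap (fun (a : selfAdjoint A) ξ => π a ξ) (𝓝 S), ?_, fun ξ => ?_⟩
  · rw [comap_neBot_iff]
    intro t ht
    obtain ⟨_, h1, a, rfl⟩ := mem_closure_iff_nhds.1 hmem t ht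
    exact ⟨a, h1⟩
  · exact (tendsto_pi_nhds.1 tendsto_comap) ξ

/-- The **Kaplansky density theorem** for an irreducible representation: every self-adjoint operator
is the strong limit of the images of a bounded net of self-adjoint elements. -/
theorem IsIrreducibleRep.exists_bddStrongTendsto (hπ : IsIrreducibleRep π) {T : H →L[ℂ] H}
    (hT : IsSelfAdjoint T) : ∃ (l : Filter (selfAdjoint A)) (c : selfAdjoint A → A), l.NeBot ∧
      (∀ i, IsSelfAdjoint (c i)) ∧ (∃ R, ∀ i, ‖c i‖ ≤ R) ∧
      BddStrongTendsto (fun i => π (c i)) l T := by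
  obtain ⟨R, hR, hTR⟩ : ∃ R : ℝ, 0 < R ∧ ∀ t ∈ spectrum ℝ T, |t| < R :=
    ⟨‖T‖ + 1, by positivity, fun t ht => by
      have := hπ.1
      exact (spectrum.norm_le_norm_of_mem ht).trans_lt (lt_add_one _)⟩
  -- `F` takes values in `[-2R, 2R]`, and `g` is a right inverse of it on the spectrum of `T`.
  -- Applying `F` to a possibly unbounded net approximating `g(T)` gives a bounded net approximating
  -- `F(g(T)) = T`.
  let F : ℝ → ℝ := fun t => 4 * R * invOneAddSq t - 2 * R
  have hF : Continuous F := (continuous_const.mul continuous_invOneAddSq).sub continuous_const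
  let g : ℝ → ℝ := fun t => √(4 * R / (t + 2 * R) - 1)
  have hpos : ∀ t ∈ spectrum ℝ T, 0 < t + 2 * R := fun t ht => by
    have := (abs_lt.1 (hTR t ht)).1
    linarith
  have hg : ContinuousOn g (spectrum ℝ T) := by
    refine ContinuousOn.sqrt (ContinuousOn.sub (ContinuousOn.div continuousOn_const
      (by fun_prop) fun t ht => (hpos t ht).ne') continuousOn_const)
  have hFg : ∀ t ∈ spectrum ℝ T, F (g t) = t := by
    intro t ht
    have h1 := hpos t ht
    have h2 := (abs_lt.1 (hTR t ht)).2
    have h3 : 0 ≤ 4 * R / (t + 2 * R) - 1 := by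
      rw [sub_nonneg, one_le_div h1]
      linarith
    simp only [F, g, invOneAddSq, Real.sq_sqrt h3]
    rw [add_sub_cancel, inv_div]
    field_simp
    ring
  have hFx : ∀ {B : Type _} [CStarAlgebra B] (x : B), IsSelfAdjoint x →
      cfc F x = algebraMap ℝ B (4 * R) * cfc invOneAddSq x - algebraMap ℝ B (2 * R) := by
    intro B _ x hx
    rw [cfc_sub _ _ x (by exact (continuous_const.mul continuous_invOneAddSq).continuousOn),
      cfc_const_mul _ _ x continuous_invOneAddSq.continuousOn, cfc_const _ x, Algebra.smul_def]
  have hS : IsSelfAdjoint (cfc g T) := IsSelfAdjoint.cfc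
  have hFS : cfc F (cfc g T) = T := by
    rw [← cfc_comp F g T hT hF.continuousOn hg]
    nth_rw 2 [← cfc_id ℝ T]
    exact cfc_congr hFg
  obtain ⟨l, hl, hlim⟩ := hπ.exists_tendsto_selfAdjoint hS
  refine ⟨l, fun a => cfc F (a : A), hl, fun a => IsSelfAdjoint.cfc, ⟨2 * R, fun a => ?_⟩, ?_⟩
  · refine norm_cfc_le (by positivity) fun t _ => ?_
    have := invOneAddSq_mem_Icc t
    rw [Real.norm_eq_abs, abs_le]
    constructor <;> simp only [F] <;> nlinarith [this.1, this.2]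
  · have h1 := ((BddStrongTendsto.const (l := l) (algebraMap ℝ (H →L[ℂ] H) (4 * R))).mul
      (bddStrongTendsto_invOneAddSq (fun a : selfAdjoint A => a.2.map π) hS hlim)).sub
      (BddStrongTendsto.const (algebraMap ℝ (H →L[ℂ] H) (2 * R)))
    rw [← hFx _ hS, hFS] at h1
    convert h1 using 2 with a
    rw [← hFx _ (a.2.map π), map_cfc_real π a.2 hF.continuousOn]

/-- The function `t ↦ √(M / max t M)`; conjugation with it cuts a positive element down to a
positive element below `M`. -/
noncomputable def cutoff (M t : ℝ) : ℝ := √(M / max t M)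

theorem continuous_cutoff {M : ℝ} (hM : 0 < M) : Continuous (cutoff M) :=
  (continuous_const.div (by fun_prop) fun _ => (lt_max_of_lt_right hM).ne').sqrt

theorem cutoff_eq_one {M t : ℝ} (hM : 0 < M) (ht : t ≤ M) : cutoff M t = 1 := by
  rw [cutoff, max_eq_right ht, div_self hM.ne', Real.sqrt_one]

theorem cutoff_mul_mul_le {M t : ℝ} (hM : 0 < M) :
    cutoff M t * t * cutoff M t ≤ M := by
  have hmax : 0 < max t M := lt_max_of_lt_right hM
  have h : cutoff M t * t * cutoff M t = t * (M / max t M) := by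
    rw [cutoff, mul_right_comm, Real.mul_self_sqrt (div_nonneg hM.le hmax.le), mul_comm]
  rw [h, ← mul_div_assoc, div_le_iff₀ hmax, mul_comm t]
  exact mul_le_mul_of_nonneg_left (le_max_left _ _) hM.le

theorem cfc_cutoff_mul_mul_le {B : Type v} [CStarAlgebra B] [PartialOrder B] [StarOrderedRing B]
    {M : ℝ} (hM : 0 < M) {b : B} (hb : 0 ≤ b) :
    cfc (cutoff M) b * b * cfc (cutoff M) b ≤ algebraMap ℝ B M := by
  have hsa := IsSelfAdjoint.of_nonneg hb
  have hc := continuous_cutoff hM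
  have h1 : cfc (cutoff M) b * b * cfc (cutoff M) b =
      cfc (fun t => cutoff M t * t * cutoff M t) b := by
    rw [cfc_mul _ _ b (by exact (hc.mul continuous_id).continuousOn) hc.continuousOn,
      cfc_mul _ _ b hc.continuousOn (continuousOn_id' _), cfc_id' ℝ b]
  rw [h1]
  exact cfc_le_algebraMap _ _ _ (fun _ _ => cutoff_mul_mul_le hM)
    (by exact ((hc.mul continuous_id).mul hc).continuousOn) hsa

/-- For an irreducible representation `π`, every pair `0 ≤ X ≤ Y ≤ M` of operators is a strong
limit of images of pairs with the same property. -/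
theorem IsIrreducibleRep.exists_bddStrongTendsto_of_le [PartialOrder A] [StarOrderedRing A]
    (hπ : IsIrreducibleRep π) {M : ℝ} (hM : 0 < M) {X Y : H →L[ℂ] H} (hX : 0 ≤ X) (hXY : X ≤ Y)
    (hY : Y ≤ algebraMap ℝ _ M) : ∃ (l : Filter (selfAdjoint A × selfAdjoint A))
      (x y : selfAdjoint A × selfAdjoint A → A), l.NeBot ∧
      (∀ i, 0 ≤ x i) ∧ (∀ i, x i ≤ y i) ∧ (∀ i, y i ≤ algebraMap ℝ A M) ∧
      BddStrongTendsto (fun i => π (x i)) l X ∧ BddStrongTendsto (fun i => π (y i)) l Y := by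
  -- Approximating square roots of `X` and `Y - X`, and then squaring, makes the approximants
  -- satisfy `0 ≤ a ≤ b` exactly.
  have hroot : ∀ Z : H →L[ℂ] H, 0 ≤ Z → ∃ z, IsSelfAdjoint z ∧ z * z = Z := fun Z hZ =>
    ⟨CFC.sqrt Z, .of_nonneg (CFC.sqrt_nonneg Z), CFC.sqrt_mul_sqrt_self Z hZ⟩
  obtain ⟨d, hd, hdX⟩ := hroot _ hX
  obtain ⟨e, he, heY⟩ := hroot _ (sub_nonneg.2 hXY)
  obtain ⟨l, c, hl, hc, ⟨R, hR⟩, hcd⟩ := hπ.exists_bddStrongTendsto hd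
  obtain ⟨l', c', hl', hc', ⟨R', hR'⟩, hce⟩ := hπ.exists_bddStrongTendsto he
  let a : selfAdjoint A × selfAdjoint A → A := fun i => c i.1 * c i.1
  let b : selfAdjoint A × selfAdjoint A → A := fun i => a i + c' i.2 * c' i.2
  have ha0 : ∀ i, 0 ≤ a i := fun i => (hc i.1).mul_self_nonneg
  have hab : ∀ i, a i ≤ b i := fun i => le_add_of_nonneg_right (hc' i.2).mul_self_nonneg
  have hb0 : ∀ i, 0 ≤ b i := fun i => (ha0 i).trans (hab i)
  have hbsa : ∀ i, IsSelfAdjoint (b i) := fun i => .of_nonneg (hb0 i)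
  have hbn : ∀ i, ‖b i‖ ≤ R * R + R' * R' := fun i =>
    (norm_add_le _ _).trans (add_le_add
      ((norm_mul_le _ _).trans (mul_self_le_mul_self (norm_nonneg _) (hR _)))
      ((norm_mul_le _ _).trans (mul_self_le_mul_self (norm_nonneg _) (hR' _))))
  have halim : BddStrongTendsto (fun i => π (a i)) (l ×ˢ l') X := by
    rw [← hdX]
    simpa only [a, map_mul] using (hcd.comp tendsto_fst).mul (hcd.comp tendsto_fst)
  have hblim : BddStrongTendsto (fun i => π (b i)) (l ×ˢ l') Y := by
    have h := halim.add ((hce.comp (tendsto_snd (f := l))).mul (hce.comp tendsto_snd))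
    rw [heY, add_sub_cancel] at h
    simpa only [b, map_add, map_mul] using h
  have hbs : ∀ i, spectrum ℝ (b i) ⊆ Set.Icc 0 (max (R * R + R' * R') M) := fun i =>
    spectrum_subset_Icc (by simpa using hb0 i)
      ((hbsa i).le_algebraMap_norm_self.trans
        (algebraMap_mono A ((hbn i).trans (le_max_left _ _))))
  have hYs : spectrum ℝ Y ⊆ Set.Icc 0 M :=
    spectrum_subset_Icc (by simpa using hX.trans hXY) hY
  have hYsa : IsSelfAdjoint Y := .of_nonneg (hX.trans hXY)
  have hc := continuous_cutoff hM
  -- The cutoff is `1` on the spectrum of `Y ≤ M`, so conjugating by it enforces the bound `M`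
  -- without changing the order or the limits.
  have hglim : BddStrongTendsto (fun i => π (cfc (cutoff M) (b i))) (l ×ˢ l') 1 := by
    have h := hblim.cfc hc.continuousOn (fun i => (hbsa i).map π) hYsa
      (fun i => (spectrum_real_map_subset π _).trans (hbs i))
      (hYs.trans (Set.Icc_subset_Icc_right (le_max_right _ _)))
    rw [cfc_congr (g := fun _ => 1) fun t ht => cutoff_eq_one hM (hYs ht).2,
      cfc_const_one ℝ Y hYsa] at h
    simpa only [map_cfc_real π (hbsa _) hc.continuousOn] using h
  have hGsa : ∀ i, IsSelfAdjoint (cfc (cutoff M) (b i)) := fun i => IsSelfAdjoint.cfc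
  refine ⟨l ×ˢ l', fun i => cfc (cutoff M) (b i) * a i * cfc (cutoff M) (b i),
    fun i => cfc (cutoff M) (b i) * b i * cfc (cutoff M) (b i), inferInstance,
    fun i => (hGsa i).conjugate_nonneg (ha0 i), fun i => (hGsa i).conjugate_le_conjugate (hab i),
    fun i => cfc_cutoff_mul_mul_le hM (hb0 i), ?_, ?_⟩
  · simpa only [map_mul, one_mul, mul_one] using (hglim.mul halim).mul hglim
  · simpa only [map_mul, one_mul, mul_one] using (hglim.mul hblim).mul hglim

/-- A function that is operator monotone for `A` is operator monotone for `B(H)`, for every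
irreducible representation of `A` on `H`. -/
theorem IsIrreducibleRep.monotoneClass_subset [PartialOrder A] [StarOrderedRing A]
    (hπ : IsIrreducibleRep π) {I : Set ℝ} (hI : I.OrdConnected) (hI' : I.Nontrivial) :
    monotoneClass A I ⊆ monotoneClass (H →L[ℂ] H) I := by
  intro f hf
  rw [mem_monotoneClass_iff hI hI'] at hf ⊢
  refine ⟨hf.1, fun α hα β hβ hαβ X Y hαX hXY hYβ => ?_⟩
  -- Translation by `α` turns `α ≤ X ≤ Y ≤ β` into `0 ≤ X ≤ Y ≤ M` with `M = β - α`.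
  obtain ⟨l, x, y, hl, hx, hxy, hy, hxlim, hylim⟩ := hπ.exists_bddStrongTendsto_of_le
    (sub_pos.2 hαβ) (sub_nonneg.2 hαX) (sub_le_sub_right hXY _)
    (by rw [map_sub]; exact sub_le_sub_right hYβ _)
  have hαx : ∀ i, algebraMap ℝ A α ≤ x i + algebraMap ℝ A α := fun i =>
    le_add_of_nonneg_left (hx i)
  have hxy' : ∀ i, x i + algebraMap ℝ A α ≤ y i + algebraMap ℝ A α := fun i =>
    add_le_add_left (hxy i) _
  have hyβ : ∀ i, y i + algebraMap ℝ A α ≤ algebraMap ℝ A β := fun i => by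
    have := add_le_add_left (hy i) (algebraMap ℝ A α)
    rwa [← map_add, sub_add_cancel] at this
  have hsub : Set.Icc α β ⊆ I := hI.out hα hβ
  have hlim : ∀ {z : selfAdjoint A × selfAdjoint A → A} {Z : H →L[ℂ] H},
      (∀ i, algebraMap ℝ A α ≤ z i + algebraMap ℝ A α) →
      (∀ i, z i + algebraMap ℝ A α ≤ algebraMap ℝ A β) →
      algebraMap ℝ _ α ≤ Z → Z ≤ algebraMap ℝ _ β →
      BddStrongTendsto (fun i => π (z i)) l (Z - algebraMap ℝ _ α) →
      BddStrongTendsto (fun i => π (cfc f (z i + algebraMap ℝ A α))) l (cfc f Z) := by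
    intro z Z h1 h2 h3 h4 h
    have hz := h.add (.const (algebraMap ℝ _ α))
    simp only [sub_add_cancel] at hz
    have hsa := fun i => isSelfAdjoint_of_algebraMap_le (h1 i)
    have hs := fun i => spectrum_subset_Icc (h1 i) (h2 i)
    have hmap : ∀ i, π (z i) + algebraMap ℝ _ α = π (z i + algebraMap ℝ A α) := fun i => by
      rw [map_add, map_algebraMap_real]
    simp only [hmap] at hz
    have := hz.cfc (hf.1.mono hsub) (fun i => (hsa i).map π) (isSelfAdjoint_of_algebraMap_le h3)
      (fun i => (spectrum_real_map_subset π _).trans (hs i)) (spectrum_subset_Icc h3 h4)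
    have hc : ∀ i, cfc f (π (z i + algebraMap ℝ A α)) = π (cfc f (z i + algebraMap ℝ A α)) :=
      fun i => (map_cfc_real π (hsa i) (hf.1.mono ((hs i).trans hsub))).symm
    simpa only [hc] using this
  exact (hlim hαx (fun i => (hxy' i).trans (hyβ i)) hαX (hXY.trans hYβ) hxlim).le_of_le
    (hlim (fun i => (hαx i).trans (hxy' i)) hyβ (hαX.trans hXY) hYβ hylim)
    (fun i => OrderHomClass.mono π (hf.2 α hα β hβ hαβ _ _ (hαx i) (hxy' i) (hyβ i)))
    IsSelfAdjoint.cfc IsSelfAdjoint.cfc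

end Kaplansky

/-! ### Pure states, GNS and detection of positivity -/

section PureStates

open Filter Topology ComplexOrder UniformSpace

variable {A : Type u} [CStarAlgebra A] [PartialOrder A] [StarOrderedRing A]

namespace PositiveLinearMap

/-- The canonical cyclic vector of the GNS representation. -/
noncomputable def gnsVector (f : A →ₚ[ℂ] ℂ) : f.GNS := (f.toPreGNS 1 : f.PreGNS)

theorem gnsStarAlgHom_gnsVector (f : A →ₚ[ℂ] ℂ) (a : A) :
    f.gnsStarAlgHom a f.gnsVector = (f.toPreGNS a : f.PreGNS) := by
  change f.gnsNonUnitalStarAlgHom a (f.toPreGNS 1 : f.PreGNS) = _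
  rw [gnsNonUnitalStarAlgHom_apply_coe]
  simp

theorem inner_gnsVector (f : A →ₚ[ℂ] ℂ) (a : A) :
    inner ℂ f.gnsVector (f.gnsStarAlgHom a f.gnsVector) = f a := by
  rw [gnsStarAlgHom_gnsVector, gnsVector, Completion.inner_coe, preGNS_inner_def]
  simp

theorem norm_gnsVector_sq (f : A →ₚ[ℂ] ℂ) : ((‖f.gnsVector‖ ^ 2 : ℝ) : ℂ) = f 1 := by
  rw [← inner_gnsVector f 1, map_one]
  simp [inner_self_eq_norm_sq_to_K]

theorem denseRange_gnsVector (f : A →ₚ[ℂ] ℂ) :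
    DenseRange fun a => f.gnsStarAlgHom a f.gnsVector := by
  simp only [gnsStarAlgHom_gnsVector]
  exact (Completion.denseRange_coe (α := f.PreGNS)).comp
    f.toPreGNS.surjective.denseRange (Completion.continuous_coe _)

theorem norm_apply_le_of_map_one (f : A →ₚ[ℂ] ℂ) (hf : f 1 = 1) (a : A) : ‖f a‖ ≤ ‖a‖ := by
  have h1 : ‖f.gnsVector‖ = 1 := by
    have := f.norm_gnsVector_sq
    rw [hf] at this
    norm_cast at this
    exact (pow_eq_one_iff_of_nonneg (norm_nonneg _) two_ne_zero).1 this
  rw [← inner_gnsVector]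
  refine (norm_inner_le_norm _ _).trans ?_
  rw [h1, one_mul]
  refine (ContinuousLinearMap.le_opNorm _ _).trans ?_
  rw [h1, mul_one]
  exact NonUnitalStarAlgHom.norm_apply_le f.gnsStarAlgHom a

end PositiveLinearMap

variable (A) in
/-- The states of a unital C⋆-algebra, as a subset of the weak-⋆ dual. -/
def stateSet : Set (WeakDual ℂ A) := {φ | φ 1 = 1 ∧ ∀ a : A, 0 ≤ a → 0 ≤ φ a}

/-- A state as a positive linear map. -/
noncomputable def stateSet.toPositive {φ : WeakDual ℂ A} (hφ : φ ∈ stateSet A) : A →ₚ[ℂ] ℂ :=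
  PositiveLinearMap.mk₀ (WeakDual.toStrongDual φ : A →ₗ[ℂ] ℂ) hφ.2

theorem convex_stateSet {A : Type u} [CStarAlgebra A] [PartialOrder A] : Convex ℝ (stateSet A) := by
  intro φ hφ ψ hψ s t hs ht hst
  refine ⟨?_, fun a ha => ?_⟩
  · change s • φ 1 + t • ψ 1 = 1
    rw [hφ.1, hψ.1, ← add_smul, hst, one_smul]
  · change 0 ≤ s • φ a + t • ψ a
    exact add_nonneg (smul_nonneg hs (hφ.2 a ha)) (smul_nonneg ht (hψ.2 a ha))

theorem isCompact_stateSet : IsCompact (stateSet A) := by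
  have hcl : IsClosed (stateSet A) := by
    have : stateSet A = {φ : WeakDual ℂ A | φ 1 = 1} ∩
        ⋂ (a : A) (_ : 0 ≤ a), {φ : WeakDual ℂ A | 0 ≤ φ a} := by
      ext φ
      simp [stateSet]
    rw [this]
    exact (isClosed_eq (WeakDual.eval_continuous 1) continuous_const).inter
      (isClosed_iInter fun a => isClosed_iInter fun _ =>
        isClosed_le continuous_const (WeakDual.eval_continuous a))
  refine (WeakDual.isCompact_closedBall (𝕜 := ℂ) (0 : StrongDual ℂ A) 1).of_isClosed_subset hcl ?_
  intro φ hφ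
  rw [Set.mem_preimage, mem_closedBall_zero_iff]
  refine ContinuousLinearMap.opNorm_le_bound _ zero_le_one fun a => ?_
  rw [one_mul]
  exact (stateSet.toPositive hφ).norm_apply_le_of_map_one hφ.1 a

/-- States detect positivity. -/
theorem exists_state_neg {a : A} (ha : IsSelfAdjoint a) (hneg : ¬ 0 ≤ a) :
    ∃ φ ∈ stateSet A, (φ a).re < 0 := by
  obtain ⟨g, u, hga, hgu⟩ := geometric_hahn_banach_point_closed (t := {x : A | 0 ≤ x}) (x := a)
    (fun x hx y hy s t hs ht _ => add_nonneg (smul_nonneg hs hx) (smul_nonneg ht hy))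
    CStarAlgebra.isClosed_nonneg hneg
  have hu : u < 0 := by simpa using hgu 0 le_rfl
  have hg0 : ∀ x, 0 ≤ x → 0 ≤ g x := by
    intro x hx
    by_contra! hlt
    have h := hgu ((u / g x) • x) (smul_nonneg (div_nonneg_of_nonpos hu.le hlt.le) hx)
    rw [map_smul, smul_eq_mul, div_mul_cancel₀ _ hlt.ne] at h
    exact lt_irrefl _ h
  -- If `g 1 = 0`, then `0 ≤ a + ‖a‖` gives `0 ≤ g a`, contrary to the separation.
  have hg1 : 0 < g 1 := by
    refine (hg0 1 zero_le_one).lt_of_ne fun h => ?_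
    have h1 := hg0 _ (neg_le_iff_add_nonneg'.1 ha.neg_algebraMap_norm_le_self)
    rw [map_add, Algebra.algebraMap_eq_smul_one, map_smul, ← h] at h1
    simp at h1
    linarith
  let σ : A →L[ℝ] A := (starL' ℝ : A ≃L[ℝ] A).toContinuousLinearMap
  -- Averaging over the star operation kills `I • x` for self-adjoint `x`, so the complex extension
  -- is real on self-adjoint elements; the factor normalises the value at `1`.
  let h : StrongDual ℝ A := (2 * g 1)⁻¹ • (g + g ∘L σ)
  have hh : ∀ x, h x = (2 * g 1)⁻¹ * (g x + g (star x)) := fun x => rfl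
  let φ : StrongDual ℂ A := h.extendRCLike
  have hsa : ∀ x : A, IsSelfAdjoint x → φ x = ((g x / g 1 : ℝ) : ℂ) := by
    intro x hx
    have h1 : h x = g x / g 1 := by
      rw [hh, hx.star_eq]
      field_simp
      ring
    have h2 : h ((Complex.I : ℂ) • x) = 0 := by
      rw [hh, star_smul, hx.star_eq]
      simp
    change (h x : ℂ) - Complex.I * (h ((Complex.I : ℂ) • x) : ℂ) = _
    rw [h1, h2]
    simp
  refine ⟨StrongDual.toWeakDual φ, ⟨?_, fun x hx => ?_⟩, ?_⟩
  · change φ 1 = 1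
    rw [hsa 1 (.one A), div_self hg1.ne', Complex.ofReal_one]
  · change 0 ≤ φ x
    rw [hsa x (.of_nonneg hx)]
    exact Complex.zero_le_real.2 (div_nonneg (hg0 x hx) hg1.le)
  · change (φ a).re < 0
    rw [hsa a ha, Complex.ofReal_re]
    exact div_neg_of_neg_of_pos (hga.trans hu) hg1

theorem continuousSMul_real_weakDual {A : Type u} [CStarAlgebra A] :
    ContinuousSMul ℝ (WeakDual ℂ A) :=
  ⟨WeakDual.continuous_of_continuous_eval fun a => by
    change Continuous fun p : ℝ × WeakDual ℂ A => p.1 • p.2 a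
    exact continuous_fst.smul ((WeakDual.eval_continuous a).comp continuous_snd)⟩

theorem locallyConvexSpace_real_weakDual {A : Type u} [CStarAlgebra A] :
    LocallyConvexSpace ℝ (WeakDual ℂ A) :=
  inferInstanceAs (LocallyConvexSpace ℝ (WeakBilin (topDualPairing ℂ A)))

/-- Krein–Milman for the weak-⋆ compact convex state space, with the dual regarded as a real vector
space. -/
theorem closure_convexHull_pureStates :
    closure (convexHull ℝ ((stateSet A).extremePoints ℝ)) = stateSet A :=
  @closure_convexHull_extremePoints (WeakDual ℂ A) _ (WeakDual.instModule' ℝ) _ _ _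
    continuousSMul_real_weakDual locallyConvexSpace_real_weakDual _ isCompact_stateSet
    convex_stateSet

theorem convex_setOf_re_nonneg {A : Type u} [CStarAlgebra A] (a : A) :
    Convex ℝ {φ : WeakDual ℂ A | 0 ≤ (φ a).re} := by
  intro φ hφ ψ hψ s t hs ht _
  change 0 ≤ (s • φ a + t • ψ a).re
  rw [Complex.add_re, Complex.smul_re, Complex.smul_re]
  exact add_nonneg (smul_nonneg hs hφ) (smul_nonneg ht hψ)

theorem isClosed_setOf_re_nonneg {A : Type u} [CStarAlgebra A] (a : A) :
    IsClosed {φ : WeakDual ℂ A | 0 ≤ (φ a).re} :=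
  isClosed_le continuous_const (Complex.continuous_re.comp (WeakDual.eval_continuous a))

theorem stateSet_subset_of_extremePoints_subset {s : Set (WeakDual ℂ A)} (hcl : IsClosed s)
    (hcv : Convex ℝ s) (hs : (stateSet A).extremePoints ℝ ⊆ s) : stateSet A ⊆ s :=
  closure_convexHull_pureStates (A := A) ▸ closure_minimal (convexHull_min hs hcv) hcl

theorem extremePoints_stateSet_subset {A : Type u} [CStarAlgebra A] [PartialOrder A] {a : A}
    (hall : ¬ ∃ φ ∈ (stateSet A).extremePoints ℝ, (φ a).re < 0) :
    (stateSet A).extremePoints ℝ ⊆ {φ : WeakDual ℂ A | 0 ≤ (φ a).re} := by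
  intro ψ hψ
  by_contra h
  exact hall ⟨ψ, hψ, not_le.1 h⟩

/-- Pure states detect positivity. -/
theorem exists_pureState_neg {a : A} (ha : IsSelfAdjoint a) (hneg : ¬ 0 ≤ a) :
    ∃ φ ∈ (stateSet A).extremePoints ℝ, (φ a).re < 0 := by
  by_contra hall
  obtain ⟨φ, hφ, hlt⟩ := exists_state_neg ha hneg
  have h : stateSet A ⊆ {φ : WeakDual ℂ A | 0 ≤ (φ a).re} :=
    stateSet_subset_of_extremePoints_subset
      (isClosed_setOf_re_nonneg a) (convex_setOf_re_nonneg a)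
      (extremePoints_stateSet_subset hall)
  exact not_le.2 hlt (h hφ)

section VectorState

variable {H : Type v} [NormedAddCommGroup H] [InnerProductSpace ℂ H] [CompleteSpace H]

/-- The functional `a ↦ ⟪η, π a η⟫ / ‖η‖²` of a representation `π`. -/
noncomputable def vectorState (π : A →⋆ₐ[ℂ] (H →L[ℂ] H)) (η : H) : WeakDual ℂ A :=
  StrongDual.toWeakDual <| LinearMap.mkContinuous
    { toFun := fun a => ((‖η‖ ^ 2)⁻¹ : ℝ) • inner ℂ η (π a η)
      map_add' := fun a b => by rw [map_add, add_apply, inner_add_right, smul_add]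
      map_smul' := fun c a => by
        rw [map_smul, smul_apply, inner_smul_right, RingHom.id_apply, smul_eq_mul, mul_smul_comm] }
    ((‖η‖ ^ 2)⁻¹ * (‖η‖ * ‖η‖)) fun a => by
      simp only [LinearMap.coe_mk, AddHom.coe_mk, norm_smul, mul_assoc]
      rw [Real.norm_of_nonneg (by positivity)]
      refine mul_le_mul_of_nonneg_left ((norm_inner_le_norm _ _).trans ?_) (by positivity)
      refine mul_le_mul_of_nonneg_left ?_ (norm_nonneg _)
      rw [mul_comm]
      exact ContinuousLinearMap.le_of_opNorm_le _ (NonUnitalStarAlgHom.norm_apply_le π a) _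

theorem vectorState_apply (π : A →⋆ₐ[ℂ] (H →L[ℂ] H)) (η : H) (a : A) :
    vectorState π η a = ((‖η‖ ^ 2)⁻¹ : ℝ) • inner ℂ η (π a η) := rfl

theorem vectorState_mem (π : A →⋆ₐ[ℂ] (H →L[ℂ] H)) {η : H} (hη : η ≠ 0) :
    vectorState π η ∈ stateSet A := by
  refine ⟨?_, fun a ha => ?_⟩
  · rw [vectorState_apply, map_one, one_apply_eq_self, inner_self_eq_norm_sq_to_K]
    have : (‖η‖ : ℂ) ≠ 0 := by simpa using hη
    simp [this]
  · rw [vectorState_apply]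
    have h : 0 ≤ π a := map_zero π ▸ OrderHomClass.mono π ha
    exact smul_nonneg (by positivity)
      (((ContinuousLinearMap.nonneg_iff_isPositive _).1 h).inner_nonneg_right η)

end VectorState

/-- A cyclic representation that induces a pure state is irreducible. -/
theorem isIrreducibleRep_of_mem_extremePoints {H : Type v} [NormedAddCommGroup H]
    [InnerProductSpace ℂ H] [CompleteSpace H] {π : A →⋆ₐ[ℂ] (H →L[ℂ] H)} {ξ : H}
    (hdense : DenseRange fun a => π a ξ) {φ : WeakDual ℂ A}
    (hφπ : ∀ a, φ a = inner ℂ ξ (π a ξ)) (hφ : φ ∈ (stateSet A).extremePoints ℝ) :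
    IsIrreducibleRep π := by
  have hξ : ‖ξ‖ ^ 2 = 1 := by
    have h := hφπ 1
    rw [hφ.1.1, map_one, one_apply_eq_self, inner_self_eq_norm_sq_to_K] at h
    exact Complex.ofReal_injective (by simpa using h.symm)
  have hξ0 : ξ ≠ 0 := by
    rintro h
    simp [h] at hξ
  refine ⟨⟨ξ, 0, hξ0⟩, fun K hK hinv => ?_⟩
  have : CompleteSpace K := hK.completeSpace_coe
  have hadj : ∀ a v w, inner ℂ (π a v) w = inner ℂ v (π (star a) w) := fun a v w => by
    rw [map_star, ContinuousLinearMap.star_eq_adjoint, ContinuousLinearMap.adjoint_inner_right]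
  have hP : ∀ a v, K.starProjection (π a v) = π a (K.starProjection v) := fun a v => by
    refine (Submodule.eq_starProjection_of_mem_of_inner_eq_zero
      (hinv a _ (Submodule.starProjection_apply_mem _ _)) fun w hw => ?_)
    rw [← map_sub, hadj]
    exact Submodule.starProjection_inner_eq_zero v _ (hinv _ w hw)
  set η := K.starProjection ξ with hη_def
  have hKη : η ∈ K := Submodule.starProjection_apply_mem _ _
  have hPη : K.starProjection η = η := Submodule.starProjection_eq_self_iff.2 hKη
  -- a scalar multiple relation for `η` propagates to the whole space
  have hscalar : ∀ c : ℂ, η = c • ξ → ∀ v, K.starProjection v = c • v := by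
    intro c hc v
    refine hdense.induction_on (p := fun v => K.starProjection v = c • v) v
      (isClosed_eq (by fun_prop) (by fun_prop)) fun a => ?_
    rw [hP, ← hη_def, hc, map_smul]
  by_cases h0 : η = 0
  · left
    rw [Submodule.eq_bot_iff]
    intro v hv
    rw [← Submodule.starProjection_eq_self_iff.2 hv, hscalar 0 (by simp [h0]) v, zero_smul]
  by_cases h1 : ξ - η = 0
  · right
    rw [Submodule.eq_top_iff']
    intro v
    rw [← Submodule.starProjection_eq_self_iff, hscalar 1 (by rw [one_smul, sub_eq_zero.1 h1]) v,
      one_smul]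
  exfalso
  have horth : ∀ v ∈ K, inner ℂ v (ξ - η) = 0 := fun v hv => by
    rw [← inner_conj_symm, Submodule.starProjection_inner_eq_zero ξ v hv, map_zero]
  have hpos0 : 0 < ‖η‖ ^ 2 := by have := norm_pos_iff.2 h0; positivity
  have hpos1 : 0 < ‖ξ - η‖ ^ 2 := by have := norm_pos_iff.2 h1; positivity
  have hsum : ‖η‖ ^ 2 + ‖ξ - η‖ ^ 2 = 1 := by
    have h := norm_add_sq_eq_norm_sq_add_norm_sq_of_inner_eq_zero η (ξ - η) (horth η hKη)
    rw [add_sub_cancel] at h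
    rw [← hξ, sq, sq, sq, h]
  have hdecomp : ∀ a, φ a = inner ℂ η (π a η) + inner ℂ (ξ - η) (π a (ξ - η)) := by
    intro a
    have h2 : inner ℂ η (π a (ξ - η)) = 0 := by
      rw [← star_star a, ← hadj]
      exact horth _ (hinv _ _ hKη)
    have h3 : inner ℂ (ξ - η) (π a η) = 0 :=
      Submodule.starProjection_inner_eq_zero ξ _ (hinv _ _ hKη)
    calc φ a = inner ℂ (η + (ξ - η)) (π a (η + (ξ - η))) := by
          rw [add_sub_cancel]; exact hφπ a
      _ = _ := by rw [map_add, inner_add_left, inner_add_right, inner_add_right, h2, h3]; ring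
  -- A nontrivial invariant subspace writes `φ` as a proper convex combination of the vector states
  -- of `η` and `ξ - η`. Extremality identifies the first with `φ`, whence `η = ‖η‖² ξ`; projecting
  -- again forces `‖η‖² = 1`, contradicting `ξ ≠ η`.
  have hext := hφ.2 (vectorState_mem π h0) (vectorState_mem π h1)
    ⟨‖η‖ ^ 2, ‖ξ - η‖ ^ 2, hpos0, hpos1, hsum, by
      refine DFunLike.ext _ _ fun a => ?_
      change (‖η‖ ^ 2) • vectorState π η a + (‖ξ - η‖ ^ 2) • vectorState π (ξ - η) a = φ a
      rw [vectorState_apply, vectorState_apply, smul_smul, smul_smul, mul_inv_cancel₀ hpos0.ne',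
        mul_inv_cancel₀ hpos1.ne', one_smul, one_smul, hdecomp]⟩
  have hηξ : η = ((‖η‖ ^ 2 : ℝ) : ℂ) • ξ := by
    refine hdense.eq_of_inner_left ℂ fun a => ?_
    have h4 := congrArg (fun ψ : WeakDual ℂ A => ψ a) hext
    simp only [vectorState_apply, hφπ] at h4
    have h5 : inner ℂ η (π a η) = inner ℂ η (π a ξ) := by
      rw [hη_def, ← hP, ← hη_def, ← Submodule.inner_starProjection_left_eq_right, hPη]
    rw [inner_smul_left, Complex.conj_ofReal, ← h4, ← h5, Complex.real_smul, ← mul_assoc,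
      ← Complex.ofReal_mul, mul_inv_cancel₀ hpos0.ne', Complex.ofReal_one, one_mul]
  have h2 := hscalar _ hηξ η
  rw [hPη] at h2
  have h3 : (1 - ((‖η‖ ^ 2 : ℝ) : ℂ)) • η = 0 := by rw [sub_smul, one_smul, ← h2, sub_self]
  rcases smul_eq_zero.1 h3 with h | h
  · have : (‖η‖ ^ 2 : ℝ) = 1 := by
      rw [sub_eq_zero] at h
      exact_mod_cast h.symm
    linarith
  · exact h0 h

/-- The GNS representation of a pure state is irreducible. -/
theorem isIrreducibleRep_gns {φ : WeakDual ℂ A} (hφ : φ ∈ (stateSet A).extremePoints ℝ) :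
    IsIrreducibleRep (stateSet.toPositive hφ.1).gnsStarAlgHom :=
  isIrreducibleRep_of_mem_extremePoints (stateSet.toPositive hφ.1).denseRange_gnsVector
    (fun a => ((stateSet.toPositive hφ.1).inner_gnsVector a).symm) hφ

/-- Irreducible representations detect positivity. -/
theorem exists_irreducibleRep_not_nonneg {a : A} (ha : IsSelfAdjoint a) (hneg : ¬ 0 ≤ a) :
    ∃ (H : Type u) (_ : NormedAddCommGroup H) (_ : InnerProductSpace ℂ H) (_ : CompleteSpace H)
      (π : A →⋆ₐ[ℂ] (H →L[ℂ] H)), IsIrreducibleRep π ∧ ¬ 0 ≤ π a := by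
  obtain ⟨φ, hφ, hlt⟩ := exists_pureState_neg ha hneg
  refine ⟨(stateSet.toPositive hφ.1).GNS, inferInstance, inferInstance, inferInstance, _,
    isIrreducibleRep_gns hφ, fun h => ?_⟩
  have h1 := ((ContinuousLinearMap.nonneg_iff_isPositive _).1 h).inner_nonneg_right
    (stateSet.toPositive hφ.1).gnsVector
  rw [PositiveLinearMap.inner_gnsVector] at h1
  exact absurd (Complex.le_def.1 h1).1 (not_le.2 hlt)

end PureStates

/-! ### Fractional linear changes of variable -/

section FractionalLinear

variable {A : Type u} [CStarAlgebra A] [PartialOrder A] [StarOrderedRing A] {I J : Set ℝ}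

theorem monotoneClass_comp {f g : ℝ → ℝ} (hf : f ∈ monotoneClass A J) (hg : g ∈ monotoneClass A I)
    (h : Set.MapsTo g I J) : f ∘ g ∈ monotoneClass A I := by
  refine ⟨hf.1.comp hg.1 h, fun x y hx hy hxI hyI hxy => ?_⟩
  have hcomp : ∀ z : A, IsSelfAdjoint z → spectrum ℝ z ⊆ I →
      cfc (f ∘ g) z = cfc f (cfc g z) ∧ spectrum ℝ (cfc g z) ⊆ J := fun z hz hzI =>
    ⟨cfc_comp f g z hz (hf.1.mono ((h.mono_left hzI).image_subset)) (hg.1.mono hzI), by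
      rw [cfc_map_spectrum (R := ℝ) g z hz (hg.1.mono hzI)]
      exact (h.mono_left hzI).image_subset⟩
  rw [(hcomp x hx hxI).1, (hcomp y hy hyI).1]
  exact hf.2 _ _ (cfc_predicate g x) (cfc_predicate g y) (hcomp x hx hxI).2 (hcomp y hy hyI).2
    (hg.2 x y hx hy hxI hyI hxy)

theorem mem_monotoneClass_of_eqOn {f g : ℝ → ℝ} (hf : f ∈ monotoneClass A I)
    (h : Set.EqOn f g I) : g ∈ monotoneClass A I := by
  refine ⟨hf.1.congr h.symm, fun x y hx hy hxI hyI hxy => ?_⟩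
  rw [← cfc_congr (h.mono hxI), ← cfc_congr (h.mono hyI)]
  exact hf.2 x y hx hy hxI hyI hxy

theorem isUnit_sub_algebraMap {A : Type u} [CStarAlgebra A] {e : ℝ} {x : A}
    (he : e ∉ spectrum ℝ x) : IsUnit (x - algebraMap ℝ A e) := by
  rw [spectrum.notMem_iff] at he
  simpa using he.neg

theorem cfc_sub_mul_inv {A : Type u} [CStarAlgebra A] (d κ e : ℝ) {x : A}
    (hx : IsSelfAdjoint x) (he : e ∉ spectrum ℝ x) :
    cfc (fun t => d - κ * (t - e)⁻¹) x =
      algebraMap ℝ A d - κ • Ring.inverse (x - algebraMap ℝ A e) := by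
  have hne : ∀ t ∈ spectrum ℝ x, t - e ≠ 0 := fun t ht h => he (sub_eq_zero.1 h ▸ ht)
  have hc : ContinuousOn (fun t => (t - e)⁻¹) (spectrum ℝ x) :=
    (continuousOn_id.sub continuousOn_const).inv₀ hne
  rw [cfc_sub (fun _ => d) (fun t => κ * (t - e)⁻¹) x continuousOn_const
    (continuousOn_const.mul hc), cfc_const d x, cfc_const_mul κ _ x hc,
    cfc_inv (fun t => t - e) x hne, cfc_sub (fun t => t) (fun _ => e) x, cfc_const e x,
    cfc_id' ℝ x]

/-- Inversion reverses the order on positive invertible elements; to the left of the pole this is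
applied to `e - x`, and the two sign changes cancel. -/
theorem sub_mul_inv_mem_monotoneClass {d κ e : ℝ} (hκ : 0 ≤ κ)
    (h : I ⊆ Set.Ioi e ∨ I ⊆ Set.Iio e) :
    (fun t => d - κ * (t - e)⁻¹) ∈ monotoneClass A I := by
  have heI : e ∉ I := fun he => by rcases h with h | h <;> exact lt_irrefl e (h he)
  refine ⟨continuousOn_const.sub (continuousOn_const.mul
    ((continuousOn_id.sub continuousOn_const).inv₀ fun t ht h =>
      heI ((sub_eq_zero.1 h : t = e) ▸ ht))),
    fun x y hx hy hxI hyI hxy => ?_⟩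
  have hxe := fun h' => heI (hxI h')
  have hye := fun h' => heI (hyI h')
  rw [cfc_sub_mul_inv d κ e hx hxe, cfc_sub_mul_inv d κ e hy hye]
  refine sub_le_sub_left (smul_le_smul_of_nonneg_left ?_ hκ) _
  rcases h with h | h
  · refine CStarAlgebra.ringInverse_le_ringInverse (sub_le_sub_right hxy _)
      ⟨sub_nonneg.2 ?_, isUnit_sub_algebraMap hxe⟩
    exact (algebraMap_le_iff_le_spectrum hx).2 fun t ht => (h (hxI ht)).le
  · have hneg : ∀ z : A, Ring.inverse (z - algebraMap ℝ A e) =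
        -Ring.inverse (algebraMap ℝ A e - z) := fun z => by
      rw [← neg_sub, ← neg_one_mul, Ring.mul_inverse_rev' (Commute.neg_one_left _),
        show Ring.inverse (-1 : A) = -1 by simpa using Ring.inverse_unit (-1 : Aˣ), mul_neg_one]
    rw [hneg, hneg, neg_le_neg_iff]
    refine CStarAlgebra.ringInverse_le_ringInverse (sub_le_sub_left hxy _)
      ⟨sub_nonneg.2 ?_, ?_⟩
    · exact (le_algebraMap_iff_spectrum_le hy).2 fun t ht => (h (hyI ht)).le
    · simpa using (isUnit_sub_algebraMap hye).neg

/-- An interval other than the line can be mapped into `[-κ, κ]` by a function that is operator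
monotone in both directions. -/
theorem exists_operatorMonotone_chart (hI : I.OrdConnected)
    (hne : I ≠ Set.univ) {κ : ℝ} (hκ : 0 < κ) :
    ∃ g h : ℝ → ℝ, Set.LeftInvOn h g I ∧ Set.MapsTo g I (Set.Icc (-κ) κ) ∧
      (∀ n, g ∈ euclideanMonotoneClass n I) ∧
      ∀ n, ∀ J ⊆ g '' I, h ∈ euclideanMonotoneClass n J := by
  obtain ⟨c, hc⟩ := (Set.ne_univ_iff_exists_notMem I).1 hne
  -- The sign `σ` records the side of `c` on which `I` lies. The pole is placed at `c - σ`, at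
  -- distance more than `1` from every point of `I`, so the chart is bounded by `κ`; its inverse has
  -- the same form with pole `0`.
  have hside : ∃ σ : ℝ, I ⊆ Set.Ioi c ∧ σ = 1 ∨ I ⊆ Set.Iio c ∧ σ = -1 := by
    by_cases h : I ⊆ Set.Ioi c
    · exact ⟨1, .inl ⟨h, rfl⟩⟩
    · refine ⟨-1, .inr ⟨fun x hx => ?_, rfl⟩⟩
      obtain ⟨y, hy, hyc⟩ := Set.not_subset.1 h
      by_contra hxc
      exact hc (hI.out hy hx ⟨not_lt.1 hyc, not_lt.1 hxc⟩)
  obtain ⟨σ, hσ⟩ := hside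
  have hpos : ∀ x ∈ I, 1 < σ * (x - (c - σ)) := by
    intro x hx
    rcases hσ with ⟨h, rfl⟩ | ⟨h, rfl⟩
    · have := Set.mem_Ioi.1 (h hx); linarith
    · have := Set.mem_Iio.1 (h hx); linarith
  have hne0 : ∀ x ∈ I, x - (c - σ) ≠ 0 := fun x hx h => by
    have := hpos x hx
    rw [h] at this
    norm_num at this
  refine ⟨fun t => 0 - κ * (t - (c - σ))⁻¹, fun s => (c - σ) - κ * (s - 0)⁻¹, fun x hx => ?_,
    fun x hx => ?_, fun n => sub_mul_inv_mem_monotoneClass hκ.le ?_,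
    fun n J hJ => sub_mul_inv_mem_monotoneClass hκ.le ?_⟩
  · have h1 := hne0 x hx
    have h2 := hκ.ne'
    simp only [zero_sub, sub_zero, inv_neg, mul_inv, inv_inv]
    rw [mul_neg, ← mul_assoc, mul_inv_cancel₀ h2]
    ring
  · rw [Set.mem_Icc, ← abs_le]
    have h1 : |(x - (c - σ))⁻¹| ≤ 1 := by
      rw [abs_inv]
      refine inv_le_one_of_one_le₀ ?_
      have h2 : |σ| = 1 := by rcases hσ with ⟨-, rfl⟩ | ⟨-, rfl⟩ <;> norm_num
      have h3 := (hpos x hx).le.trans (le_abs_self _)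
      rwa [abs_mul, h2, one_mul] at h3
    dsimp only
    rw [zero_sub, abs_neg, abs_mul, abs_of_pos hκ]
    exact mul_le_of_le_one_right hκ.le h1
  · rcases hσ with ⟨h, rfl⟩ | ⟨h, rfl⟩
    · exact .inl fun x hx => by have := hpos x hx; simp only [Set.mem_Ioi]; linarith
    · exact .inr fun x hx => by have := hpos x hx; simp only [Set.mem_Iio]; linarith
  · rcases hσ with ⟨h, rfl⟩ | ⟨h, rfl⟩
    · refine .inr fun y hy => ?_
      obtain ⟨x, hx, rfl⟩ := hJ hy
      have := hpos x hx
      have h4 : 0 < (x - (c - 1))⁻¹ := inv_pos.2 (by linarith)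
      have := mul_pos hκ h4
      simp only [Set.mem_Iio]
      linarith
    · refine .inl fun y hy => ?_
      obtain ⟨x, hx, rfl⟩ := hJ hy
      have := hpos x hx
      have h4 : (x - (c - -1))⁻¹ < 0 := inv_lt_zero.2 (by linarith)
      have := mul_neg_of_pos_of_neg hκ h4
      simp only [Set.mem_Ioi]
      linarith

end FractionalLinear

/-! ### Positivity of a truncated Hankel form -/

section HankelForm

open Finset

variable {E : Type u} [NormedAddCommGroup E] [InnerProductSpace ℂ E]

/-- The form `∑_{i + j < m} c (i + j) re ⟪v i, v j⟫`. -/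
noncomputable def hankelForm (c : ℕ → ℝ) (m : ℕ) (v : ℕ → E) : ℝ :=
  ∑ k ∈ range m, c k * ∑ p ∈ antidiagonal k, (inner ℂ (v p.1) (v p.2)).re

theorem sum_range_sum_antidiagonal {M : Type*} [AddCommMonoid M] (m : ℕ) (F : ℕ × ℕ → M) :
    ∑ k ∈ range m, ∑ p ∈ antidiagonal k, F p =
      ∑ p ∈ (range m ×ˢ range m).filter (fun p => p.1 + p.2 < m), F p := by
  rw [← sum_fiberwise_of_maps_to (g := fun p : ℕ × ℕ => p.1 + p.2) (t := range m)
    (by simp +contextual)]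
  refine sum_congr rfl fun k hk => sum_congr ?_ fun _ _ => rfl
  ext p
  simp only [HasAntidiagonal.mem_antidiagonal, mem_filter, mem_product, mem_range] at hk ⊢
  omega

theorem hankelForm_eq (c : ℕ → ℝ) (m : ℕ) (v : ℕ → E) : hankelForm c m v =
    ∑ p ∈ (range m ×ˢ range m).filter (fun p => p.1 + p.2 < m),
      c (p.1 + p.2) * (inner ℂ (v p.1) (v p.2)).re := by
  rw [hankelForm, ← sum_range_sum_antidiagonal m
    fun p => c (p.1 + p.2) * (inner ℂ (v p.1) (v p.2)).re]
  refine sum_congr rfl fun k _ => ?_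
  rw [mul_sum]
  exact sum_congr rfl fun p hp => by rw [HasAntidiagonal.mem_antidiagonal.1 hp]

theorem abs_re_inner_le (u w : E) : |(inner ℂ u w).re| ≤ ‖u‖ * ‖w‖ :=
  (Complex.abs_re_le_norm _).trans (norm_inner_le_norm u w)

/-- A diagonally dominant Hankel form: the entry at `(i, j)` of the coefficient matrix is
`R ^ (2 * i ^ 2) * R ^ (2 * j ^ 2)` times `R ^ (-(i - j) ^ 2)`. -/
theorem le_sum_hankel {n : ℕ} {R : ℝ} (hn : 1 ≤ n) (hR : 2 * n ≤ R) (v : ℕ → E) :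
    (∑ i ∈ range n, ‖v i‖ ^ 2) / 2 ≤
      ∑ p ∈ range n ×ˢ range n, R ^ ((p.1 + p.2) ^ 2) * (inner ℂ (v p.1) (v p.2)).re := by
  have hn' : (1 : ℝ) ≤ n := by exact_mod_cast hn
  have hR1 : 1 ≤ R := by linarith
  have hR0 : 0 < R := by linarith
  set w : ℕ → ℝ := fun i => R ^ (4 * i ^ 2) * ‖v i‖ ^ 2 with hw
  have hvw : ∀ i, ‖v i‖ ^ 2 ≤ w i := fun i =>
    le_mul_of_one_le_left (sq_nonneg _) (one_le_pow₀ hR1)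
  -- Off the diagonal `(i - j)² ≥ 1` gains a factor `R`, and AM–GM splits the product. Summed over
  -- all pairs the errors total `n W / R ≤ W / 2`, where `W = ∑ w i`.
  have hterm : ∀ i j, (if i = j then w i else 0) - (w i + w j) / (2 * R) ≤
      R ^ ((i + j) ^ 2) * (inner ℂ (v i) (v j)).re := by
    intro i j
    have hwi : 0 ≤ w i := (sq_nonneg _).trans (hvw i)
    have hwj : 0 ≤ w j := (sq_nonneg _).trans (hvw j)
    by_cases hij : i = j
    · subst hij
      rw [if_pos rfl]
      have h1 : (inner ℂ (v i) (v i)).re = ‖v i‖ ^ 2 := inner_self_eq_norm_sq (𝕜 := ℂ) (v i)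
      have h2 : (i + i) ^ 2 = 4 * i ^ 2 := by ring
      rw [h1, h2]
      have : 0 ≤ (w i + w i) / (2 * R) := by positivity
      linarith
    · rw [if_neg hij, zero_sub]
      have hexp : (i + j) ^ 2 + 1 ≤ 2 * i ^ 2 + 2 * j ^ 2 := by
        rcases lt_or_gt_of_ne hij with h | h
        · obtain ⟨d, rfl⟩ := Nat.exists_eq_add_of_lt h
          nlinarith
        · obtain ⟨d, rfl⟩ := Nat.exists_eq_add_of_lt h
          nlinarith
      have h1 : R ^ ((i + j) ^ 2) * R ≤ R ^ (2 * i ^ 2) * R ^ (2 * j ^ 2) := by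
        rw [← pow_succ, ← pow_add]
        exact pow_le_pow_right₀ hR1 hexp
      have h2 : R ^ ((i + j) ^ 2) * (‖v i‖ * ‖v j‖) * (2 * R) ≤ w i + w j := by
        have e1 : w i = (R ^ (2 * i ^ 2) * ‖v i‖) ^ 2 := by
          rw [hw, mul_pow, ← pow_mul]; ring_nf
        have e2 : w j = (R ^ (2 * j ^ 2) * ‖v j‖) ^ 2 := by
          rw [hw, mul_pow, ← pow_mul]; ring_nf
        calc R ^ ((i + j) ^ 2) * (‖v i‖ * ‖v j‖) * (2 * R)
            = 2 * ((R ^ ((i + j) ^ 2) * R) * (‖v i‖ * ‖v j‖)) := by ring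
          _ ≤ 2 * ((R ^ (2 * i ^ 2) * R ^ (2 * j ^ 2)) * (‖v i‖ * ‖v j‖)) := by gcongr
          _ ≤ w i + w j := by
            rw [e1, e2]
            nlinarith [sq_nonneg (R ^ (2 * i ^ 2) * ‖v i‖ - R ^ (2 * j ^ 2) * ‖v j‖)]
      have h3 : R ^ ((i + j) ^ 2) * (‖v i‖ * ‖v j‖) ≤ (w i + w j) / (2 * R) := by
        rwa [le_div_iff₀ (by positivity)]
      have h4 : -(‖v i‖ * ‖v j‖) ≤ (inner ℂ (v i) (v j)).re :=
        (abs_le.1 (abs_re_inner_le _ _)).1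
      have h5 := mul_le_mul_of_nonneg_left h4 (pow_nonneg hR0.le ((i + j) ^ 2))
      linarith
  refine le_trans ?_ (sum_le_sum fun p _ => hterm p.1 p.2)
  rw [sum_product]
  have hrow : ∀ i ∈ range n, ∑ j ∈ range n, ((if i = j then w i else 0) - (w i + w j) / (2 * R)) =
      w i - (n * w i + ∑ j ∈ range n, w j) / (2 * R) := by
    intro i hi
    rw [sum_sub_distrib, sum_ite_eq, if_pos hi, ← sum_div, sum_add_distrib, sum_const, card_range,
      nsmul_eq_mul]
  rw [sum_congr rfl hrow, sum_sub_distrib, ← sum_div, sum_add_distrib, sum_const, card_range,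
    nsmul_eq_mul, ← mul_sum]
  set W := ∑ j ∈ range n, w j with hW
  have hvW : ∑ i ∈ range n, ‖v i‖ ^ 2 ≤ W := sum_le_sum fun i _ => hvw i
  have hW0 : 0 ≤ W := (sum_nonneg fun i _ => sq_nonneg ‖v i‖).trans hvW
  have h6 : (n * W + n * W) / (2 * R) ≤ W / 2 := by
    rw [div_le_div_iff₀ (by positivity) (by positivity)]
    nlinarith
  linarith

/-- The leading `n × n` block contributes at least `s² / 2`. Every other term has an index `≥ n`, so
its inner product is at most `θ s²`; there are at most `(2n)²` such terms, with coefficients at most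
`(2n)^((2n)²)`, and `hθn` is exactly the bound under which the block wins. -/
theorem hankelForm_nonneg {n : ℕ} (hn : 1 ≤ n) {θ s : ℝ} {v : ℕ → E} (hθ : 0 ≤ θ) (hθ1 : θ ≤ 1)
    (hθn : (2 * n) ^ 2 * (2 * n : ℝ) ^ ((2 * n) ^ 2) * θ ≤ 1 / 2)
    (hs : ∀ i < n, ‖v i‖ ≤ s) (hs' : s ^ 2 ≤ ∑ i ∈ range n, ‖v i‖ ^ 2)
    (htail : ∀ i, n ≤ i → i < 2 * n → ‖v i‖ ≤ θ * s) :
    0 ≤ hankelForm (fun k => (2 * n : ℝ) ^ (k ^ 2)) (2 * n) v := by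
  have hs0 : 0 ≤ s := (norm_nonneg _).trans (hs 0 hn)
  have hR1 : (1 : ℝ) ≤ 2 * n := by exact_mod_cast (by omega : 1 ≤ 2 * n)
  have hsub : range n ×ˢ range n ⊆
      (range (2 * n) ×ˢ range (2 * n)).filter (fun p => p.1 + p.2 < 2 * n) := by
    intro p
    simp only [mem_product, mem_range, mem_filter]
    omega
  have hall : ∀ i < 2 * n, ‖v i‖ ≤ s := fun i hi => by
    rcases lt_or_ge i n with h | h
    · exact hs i h
    · exact (htail i h hi).trans (mul_le_of_le_one_left hs0 hθ1)
  rw [hankelForm_eq, ← sum_sdiff hsub]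
  set B := (2 * n : ℝ) ^ ((2 * n) ^ 2) * (θ * s ^ 2) with hB
  have hB0 : 0 ≤ B := by positivity
  have h1 : -(((2 * n) ^ 2 : ℝ) * B) ≤ ∑ p ∈ (range (2 * n) ×ˢ range (2 * n)).filter
      (fun p => p.1 + p.2 < 2 * n) \ (range n ×ˢ range n),
      (2 * n : ℝ) ^ ((p.1 + p.2) ^ 2) * (inner ℂ (v p.1) (v p.2)).re := by
    set S := (range (2 * n) ×ˢ range (2 * n)).filter
      (fun p => p.1 + p.2 < 2 * n) \ (range n ×ˢ range n) with hS
    have hcard : (#S : ℝ) ≤ (2 * n) ^ 2 := by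
      have : #S ≤ (2 * n) ^ 2 := by
        refine (card_le_card (sdiff_subset.trans (filter_subset _ _))).trans ?_
        rw [card_product, card_range, sq]
      exact_mod_cast this
    have hle : ∀ p ∈ S, -B ≤ (2 * n : ℝ) ^ ((p.1 + p.2) ^ 2) * (inner ℂ (v p.1) (v p.2)).re := by
      intro p hp
      simp only [hS, mem_sdiff, mem_filter, mem_product, mem_range] at hp
      obtain ⟨⟨⟨hp1, hp2⟩, hp3⟩, hp4⟩ := hp
      have hprod : ‖v p.1‖ * ‖v p.2‖ ≤ θ * s ^ 2 := by
        rcases lt_or_ge p.1 n with h | h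
        · calc ‖v p.1‖ * ‖v p.2‖ ≤ s * (θ * s) :=
                mul_le_mul (hall _ hp1) (htail _ (by omega) hp2) (norm_nonneg _) hs0
            _ = θ * s ^ 2 := by ring
        · calc ‖v p.1‖ * ‖v p.2‖ ≤ (θ * s) * s :=
                mul_le_mul (htail _ h hp1) (hall _ hp2) (norm_nonneg _) (by positivity)
            _ = θ * s ^ 2 := by ring
      have hc : (2 * n : ℝ) ^ ((p.1 + p.2) ^ 2) ≤ (2 * n : ℝ) ^ ((2 * n) ^ 2) :=
        pow_le_pow_right₀ hR1 (Nat.pow_le_pow_left hp3.le 2)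
      refine (abs_le.1 ?_).1
      rw [abs_mul, abs_of_nonneg (by positivity : (0 : ℝ) ≤ (2 * n : ℝ) ^ ((p.1 + p.2) ^ 2))]
      exact mul_le_mul hc ((abs_re_inner_le _ _).trans hprod) (abs_nonneg _) (by positivity)
    have h2 := card_nsmul_le_sum S _ _ hle
    rw [nsmul_eq_mul] at h2
    nlinarith
  have h2 := le_sum_hankel hn le_rfl v
  have h3 : ((2 * n) ^ 2 : ℝ) * B ≤ s ^ 2 / 2 := by
    have := mul_le_mul_of_nonneg_right hθn (sq_nonneg s)
    rw [hB]
    linarith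
  linarith

end HankelForm

/-! ### Derivative criteria for monotone polynomials -/

section PolySum

open Finset

/-- The polynomial `∑_{k < m} c k * x ^ (k + 1)`, evaluated in a real algebra. -/
def polySum {A : Type*} [Ring A] [Algebra ℝ A] (c : ℕ → ℝ) (m : ℕ) (x : A) : A :=
  ∑ k ∈ range m, c k • x ^ (k + 1)

theorem continuous_polySum (c : ℕ → ℝ) (m : ℕ) : Continuous (polySum c m : ℝ → ℝ) :=
  continuous_finsetSum _ fun k _ => (continuous_pow (k + 1)).const_smul (c k)

theorem cfc_polySum {A : Type u} [CStarAlgebra A] (c : ℕ → ℝ) (m : ℕ) {x : A}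
    (hx : IsSelfAdjoint x) : cfc (polySum c m : ℝ → ℝ) x = polySum c m x := by
  have h : (polySum c m : ℝ → ℝ) = ∑ k ∈ range m, fun t : ℝ => c k • t ^ (k + 1) := by
    ext t
    simp [polySum]
  rw [h, cfc_sum _ x _ fun k _ => by fun_prop]
  refine sum_congr rfl fun k _ => ?_
  rw [cfc_smul (c k) (fun t => t ^ (k + 1)) x (by fun_prop), cfc_pow_id x (k + 1) hx]

theorem isSelfAdjoint_polySum {A : Type u} [CStarAlgebra A] (c : ℕ → ℝ) (m : ℕ) {x : A}
    (hx : IsSelfAdjoint x) : IsSelfAdjoint (polySum c m x) :=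
  cfc_polySum c m hx ▸ cfc_predicate _ x

theorem hasDerivAt_polySum {A : Type u} [NormedRing A] [NormedAlgebra ℝ A] (c : ℕ → ℝ) (m : ℕ)
    (x d : A) (t : ℝ) : HasDerivAt (fun t : ℝ => polySum c m (x + t • d))
      (∑ k ∈ range m, c k •
        ∑ i ∈ range (k + 1), (x + t • d) ^ (k - i) * d * (x + t • d) ^ i) t := by
  have h : HasDerivAt (fun t : ℝ => x + t • d) d t := by
    simpa using ((hasDerivAt_id t).smul_const d).const_add x
  exact HasDerivAt.fun_sum fun k _ => (h.fun_pow' (k + 1)).const_smul (c k)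

theorem hasDerivAt_re_apply_polySum {A : Type u} [CStarAlgebra A] (c : ℕ → ℝ) (m : ℕ)
    (L : A →L[ℂ] ℂ) (x d : A) (t : ℝ) :
    HasDerivAt (fun t : ℝ => (L (polySum c m (x + t • d))).re)
      (∑ k ∈ range m, c k * ∑ i ∈ range (k + 1),
        (L ((x + t • d) ^ (k - i) * d * (x + t • d) ^ i)).re) t := by
  have h := (Complex.reCLM ∘L L.restrictScalars ℝ).hasFDerivAt.comp_hasDerivAt t
    (hasDerivAt_polySum c m x d t)
  refine h.congr_deriv ?_
  rw [map_sum]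
  refine sum_congr rfl fun k _ => ?_
  rw [map_smul, map_sum, smul_eq_mul]
  rfl

variable {A : Type u} [CStarAlgebra A] [PartialOrder A] [StarOrderedRing A]

/-- Integrates the derivative along the segment from `x` to `y`, which stays in the order interval
`[-κ, κ]` and hence in the ball of radius `κ`. -/
theorem re_apply_polySum_le (c : ℕ → ℝ) (m : ℕ) (L : A →L[ℂ] ℂ) {κ : ℝ} (hκ : 0 ≤ κ) {x y : A}
    (hx : algebraMap ℝ A (-κ) ≤ x) (hxy : x ≤ y) (hy : y ≤ algebraMap ℝ A κ)
    (h : ∀ z : A, IsSelfAdjoint z → ‖z‖ ≤ κ → 0 ≤ ∑ k ∈ range m, c k * ∑ i ∈ range (k + 1),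
        (L (z ^ (k - i) * (y - x) * z ^ i)).re) :
    (L (polySum c m x)).re ≤ (L (polySum c m y)).re := by
  have hderiv := hasDerivAt_re_apply_polySum c m L x (y - x)
  have hd := sub_nonneg.2 hxy
  have hmono : MonotoneOn (fun t : ℝ => (L (polySum c m (x + t • (y - x)))).re) (Set.Icc 0 1) := by
    refine monotoneOn_of_deriv_nonneg (convex_Icc 0 1)
      (fun t _ => (hderiv t).continuousAt.continuousWithinAt)
      (fun t _ => (hderiv t).differentiableAt.differentiableWithinAt) fun t ht => ?_
    rw [(hderiv t).deriv]
    have ht' := interior_subset ht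
    have h1 : x ≤ x + t • (y - x) := le_add_of_nonneg_right (smul_nonneg ht'.1 hd)
    have h2 : x + t • (y - x) ≤ y := by
      have h3 : 0 ≤ (1 - t) • (y - x) := smul_nonneg (sub_nonneg.2 ht'.2) hd
      rw [← sub_nonneg]
      convert h3 using 1
      rw [sub_smul, one_smul]
      abel
    have hlo := hx.trans h1
    have hz := isSelfAdjoint_of_algebraMap_le hlo
    have hnorm := norm_le_of_spectrum_subset_Icc hz (spectrum_subset_Icc hlo (h2.trans hy))
    rw [abs_neg, max_self, abs_of_nonneg hκ] at hnorm
    exact h _ hz hnorm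
  have h01 := hmono (Set.left_mem_Icc.2 zero_le_one) (Set.right_mem_Icc.2 zero_le_one) zero_le_one
  simpa using h01

/-- The converse: difference quotients at `x` in a positive direction `d` are nonnegative. The
margin `δ` keeps `x + t d` below `β` for small `t > 0`. -/
theorem nonneg_of_polySum_mem_monotoneClass {c : ℕ → ℝ} {m : ℕ} {α β δ : ℝ} (hδ : 0 < δ)
    (hc : (polySum c m : ℝ → ℝ) ∈ monotoneClass A (Set.Icc α β)) (L : A →L[ℂ] ℂ)
    (hL : ∀ a, 0 ≤ a → 0 ≤ (L a).re) {x d : A} (hd : 0 ≤ d)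
    (hα : algebraMap ℝ A α ≤ x) (hβ : x ≤ algebraMap ℝ A (β - δ)) :
    0 ≤ ∑ k ∈ range m, c k * ∑ i ∈ range (k + 1), (L (x ^ (k - i) * d * x ^ i)).re := by
  have hderiv := hasDerivAt_re_apply_polySum c m L x d 0
  simp only [zero_smul, add_zero] at hderiv
  refine ge_of_tendsto hderiv.tendsto_slope_zero_right ?_
  have hev : ∀ᶠ t : ℝ in nhdsWithin 0 (Set.Ioi 0), t * ‖d‖ < δ := by
    have h0 : Filter.Tendsto (fun t : ℝ => t * ‖d‖) (nhdsWithin 0 (Set.Ioi 0)) (nhds 0) :=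
      Filter.Tendsto.mono_left (by simpa using (continuous_mul_const ‖d‖).tendsto 0)
        nhdsWithin_le_nhds
    exact h0.eventually_lt_const hδ
  filter_upwards [hev, self_mem_nhdsWithin] with t htδ ht
  have ht0 : 0 ≤ t := le_of_lt ht
  rw [zero_add]
  refine smul_nonneg (inv_nonneg.2 ht0) (sub_nonneg.2 ?_)
  have h1 : x ≤ x + t • d := le_add_of_nonneg_right (smul_nonneg ht0 hd)
  have h2 : x + t • d ≤ algebraMap ℝ A β := by
    have h3 : t • d ≤ algebraMap ℝ A δ := by
      refine (smul_le_smul_of_nonneg_left (IsSelfAdjoint.of_nonneg hd).le_algebraMap_norm_self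
        ht0).trans ?_
      rw [← algebraMap_smul A, smul_eq_mul, ← map_mul]
      exact algebraMap_mono A htδ.le
    calc x + t • d ≤ algebraMap ℝ A (β - δ) + algebraMap ℝ A δ := add_le_add hβ h3
      _ = algebraMap ℝ A β := by rw [← map_add, sub_add_cancel]
  have hx := isSelfAdjoint_of_algebraMap_le hα
  have hy := isSelfAdjoint_of_algebraMap_le (hα.trans h1)
  have h4 := hc.2 x (x + t • d) hx hy (spectrum_subset_Icc hα (h1.trans h2))
    (spectrum_subset_Icc (hα.trans h1) h2) h1
  rw [cfc_polySum _ _ hx, cfc_polySum _ _ hy, ← sub_nonneg] at h4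
  have h5 := hL _ h4
  rw [map_sub, Complex.sub_re, sub_nonneg] at h5
  simpa using h5

end PolySum

/-! ### The derivative as a Hankel form -/

section Operators

open Finset

variable {H : Type u} [NormedAddCommGroup H] [InnerProductSpace ℂ H]

/-- The functional `T ↦ ⟪η, T η⟫`. -/
noncomputable def vectorFunctional (η : H) : (H →L[ℂ] H) →L[ℂ] ℂ :=
  innerSL ℂ η ∘L ContinuousLinearMap.apply ℂ H η

theorem vectorFunctional_nonneg {η : H} {T : H →L[ℂ] H} (hT : 0 ≤ T) :
    0 ≤ (vectorFunctional η T).re :=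
  (Complex.le_def.1 (((ContinuousLinearMap.nonneg_iff_isPositive _).1 hT).inner_nonneg_right η)).1

/-- Moving `z^(k-i)` and `star b` to the left of the inner product gives `⟪b z^(k-i) η, b z^i η⟫`.
-/
theorem sum_vectorFunctional_eq_hankelForm [CompleteSpace H] (c : ℕ → ℝ) (m : ℕ) {z b : H →L[ℂ] H}
    (hz : IsSelfAdjoint z) (η : H) :
    ∑ k ∈ range m, c k * ∑ i ∈ range (k + 1),
      (vectorFunctional η (z ^ (k - i) * (star b * b) * z ^ i)).re =
      hankelForm c m fun i => b ((z ^ i) η) := by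
  refine sum_congr rfl fun k _ => ?_
  congr 1
  rw [Finset.Nat.sum_antidiagonal_eq_sum_range_succ_mk, ← sum_range_reflect]
  refine sum_congr rfl fun i hi => ?_
  have hi' : i ≤ k := Nat.lt_succ_iff.1 (mem_range.1 hi)
  have e1 : k + 1 - 1 - i = k - i := by omega
  have e2 : k - (k - i) = i := by omega
  have hadj : ∀ (T : H →L[ℂ] H) (u w : H), inner ℂ (T u) w = inner ℂ u (star T w) :=
    fun T u w => by
      rw [ContinuousLinearMap.star_eq_adjoint, ContinuousLinearMap.adjoint_inner_right]
  simp only [e1, e2]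
  rw [hadj, hadj, (hz.pow i).star_eq]
  rfl

end Operators

/-! ### High powers of a small operator in finite dimension -/

section SmallNorm

open Finset

variable {H : Type u} [NormedAddCommGroup H] [InnerProductSpace ℂ H] [FiniteDimensional ℂ H]

/-- Cayley–Hamilton, with a bound on the coefficients. -/
theorem exists_pow_finrank_eq_sum {z : H →L[ℂ] H} {ε : ℝ} (hz : ‖z‖ ≤ ε) (hε : ε ≤ 1) :
    ∃ r : ℕ → ℂ, z ^ Module.finrank ℂ H = ∑ k ∈ range (Module.finrank ℂ H), r k • z ^ k ∧
      ∀ k < Module.finrank ℂ H, ‖r k‖ ≤ ε * 2 ^ Module.finrank ℂ H := by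
  have hε0 : 0 ≤ ε := (norm_nonneg z).trans hz
  set n := Module.finrank ℂ H with hn
  set q := (z : H →ₗ[ℂ] H).charpoly with hq
  have hdeg : q.natDegree = n := LinearMap.charpoly_natDegree _
  have hmon : q.Monic := LinearMap.charpoly_monic _
  refine ⟨fun k => -q.coeff k, ?_, fun k hk => ?_⟩
  · have h0 : Polynomial.aeval (z : H →ₗ[ℂ] H) q = 0 := LinearMap.aeval_self_charpoly _
    rw [Polynomial.aeval_eq_sum_range, hdeg, sum_range_succ, ← hdeg, hmon.coeff_natDegree, one_smul,
      hdeg] at h0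
    ext η
    have h1 := LinearMap.congr_fun h0 η
    have hpow : ∀ i, ((z : H →ₗ[ℂ] H) ^ i) η = (z ^ i) η := fun i => by
      rw [← ContinuousLinearMap.toLinearMap_pow]
      rfl
    simp only [LinearMap.add_apply, LinearMap.sum_apply, LinearMap.smul_apply, hpow,
      LinearMap.zero_apply] at h1
    simp only [neg_smul, sum_neg_distrib, neg_apply,
      _root_.sum_apply, smul_apply]
    exact eq_neg_of_add_eq_zero_right h1
  · have hroots : ∀ μ ∈ (q.map (RingHom.id ℂ)).roots, ‖μ‖ ≤ ε := by
      intro μ hμ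
      rw [Polynomial.map_id, Polynomial.mem_roots hmon.ne_zero,
        ← Module.End.hasEigenvalue_iff_isRoot_charpoly] at hμ
      obtain ⟨w, hw⟩ := hμ.exists_hasEigenvector
      have h1 : ‖z w‖ = ‖μ‖ * ‖w‖ := by
        rw [← norm_smul]
        exact congrArg norm hw.apply_eq_smul
      have h2 := z.le_of_opNorm_le hz w
      rw [h1] at h2
      exact le_of_mul_le_mul_right h2 (norm_pos_iff.2 hw.2)
    have h := Polynomial.coeff_le_of_roots_le (f := RingHom.id ℂ) k hmon
      (IsAlgClosed.splits _) hroots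
    rw [Polynomial.map_id, hdeg] at h
    rw [norm_neg]
    -- The bound on the coefficient is `ε^(n-k)` times a binomial coefficient; since `k < n`, at
    -- least one factor `ε` survives.
    refine h.trans (mul_le_mul (pow_le_of_le_one hε0 hε (by omega)) ?_ (by positivity) hε0)
    exact_mod_cast Nat.choose_le_two_pow n k

/-- Cayley–Hamilton is a linear recursion expressing each vector of index `≥ n` through its `n`
predecessors with coefficients at most `ε 2^n`; `hεn` keeps all predecessors below `s` in the
induction. -/
theorem norm_apply_pow_le {z b : H →L[ℂ] H} {ε s : ℝ} (hz : ‖z‖ ≤ ε) (hε : ε ≤ 1) {n : ℕ}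
    (hn : Module.finrank ℂ H = n) (hεn : n * (ε * 2 ^ n) ≤ 1) {η : H}
    (hs : ∀ i < n, ‖b ((z ^ i) η)‖ ≤ s) (hs0 : 0 ≤ s) {i : ℕ} (hi : n ≤ i) :
    ‖b ((z ^ i) η)‖ ≤ n * (ε * 2 ^ n) * s := by
  obtain ⟨r, hr, hrb⟩ := exists_pow_finrank_eq_sum hz hε
  rw [hn] at hr hrb
  induction i using Nat.strong_induction_on with
  | _ i ih =>
    obtain ⟨j, rfl⟩ := Nat.exists_eq_add_of_le' hi
    have hlt : ∀ l < j + n, ‖b ((z ^ l) η)‖ ≤ s := fun l hl => by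
      rcases lt_or_ge l n with h | h
      · exact hs l h
      · exact (ih l hl h).trans (mul_le_of_le_one_left hs0 hεn)
    have heq : b ((z ^ (j + n)) η) = ∑ k ∈ range n, r k • b ((z ^ (j + k)) η) := by
      rw [pow_add, hr, mul_sum, _root_.sum_apply, map_sum]
      refine sum_congr rfl fun k _ => ?_
      rw [mul_smul_comm, ← pow_add, smul_apply, map_smul]
    rw [heq]
    calc ‖∑ k ∈ range n, r k • b ((z ^ (j + k)) η)‖
        ≤ ∑ k ∈ range n, ε * 2 ^ n * s := by
          refine norm_sum_le_of_le _ fun k hk => ?_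
          have hk' := mem_range.1 hk
          rw [norm_smul]
          exact mul_le_mul (hrb k hk') (hlt _ (by omega)) (norm_nonneg _)
            ((norm_nonneg _).trans (hrb k hk'))
      _ = n * (ε * 2 ^ n) * s := by rw [sum_const, card_range, nsmul_eq_mul]; ring

end SmallNorm

/-! ### A polynomial in `P_n` near zero -/

section Gap

open Finset

/-- The polynomial `∑_{k < 2n} (2n) ^ (k ^ 2) * x ^ (k + 1)` is matrix monotone of order `n` near
`0`. -/
theorem exists_polySum_mem_euclideanMonotoneClass {n : ℕ} (hn : 1 ≤ n) :
    ∃ κ > 0, (polySum (fun k => (2 * n : ℝ) ^ (k ^ 2)) (2 * n) : ℝ → ℝ) ∈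
      euclideanMonotoneClass n (Set.Icc (-κ) κ) := by
  have hn' : (1 : ℝ) ≤ n := by exact_mod_cast hn
  set C : ℝ := (2 * n) ^ 2 * (2 * n : ℝ) ^ ((2 * n) ^ 2) with hC
  have hC1 : 1 ≤ C := one_le_mul_of_one_le_of_one_le (one_le_pow₀ (by linarith))
    (one_le_pow₀ (by linarith))
  -- Chosen so that `θ = n κ 2^n`, the decay factor from Cayley–Hamilton, satisfies `C θ = 1 / 2`.
  set κ : ℝ := (2 * (n * 2 ^ n) * C)⁻¹ with hκ
  have h2n : (1 : ℝ) ≤ n * 2 ^ n :=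
    one_le_mul_of_one_le_of_one_le hn' (one_le_pow₀ one_le_two)
  have hκ0 : 0 < κ := by positivity
  have hθn : C * (n * (κ * 2 ^ n)) = 1 / 2 := by
    rw [hκ]
    field_simp
  have hθ1 : n * (κ * 2 ^ n) ≤ 1 := by nlinarith [mul_pos hκ0 (by linarith : (0:ℝ) < n * 2 ^ n)]
  have hκ1 : κ ≤ 1 := by nlinarith
  refine ⟨κ, hκ0, (continuous_polySum _ _).continuousOn, fun x y hx hy hxI hyI hxy => ?_⟩
  rw [cfc_polySum _ _ hx, cfc_polySum _ _ hy]
  obtain ⟨b, hb⟩ := CStarAlgebra.nonneg_iff_eq_star_mul_self.1 (sub_nonneg.2 hxy)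
  rw [ContinuousLinearMap.le_def]
  refine ⟨ContinuousLinearMap.isSelfAdjoint_iff_isSymmetric.1
    ((isSelfAdjoint_polySum _ _ hy).sub (isSelfAdjoint_polySum _ _ hx)), fun η => ?_⟩
  rw [ContinuousLinearMap.reApplyInnerSelf_apply, inner_re_symm, sub_apply, inner_sub_right,
    map_sub, sub_nonneg]
  refine re_apply_polySum_le _ _ (vectorFunctional η) hκ0.le ((spectrum_subset_Icc_iff hx).1 hxI).1
    hxy ((spectrum_subset_Icc_iff hy).1 hyI).2 fun z hz hzκ => ?_
  rw [hb, sum_vectorFunctional_eq_hankelForm _ _ hz]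
  set v := fun i => b ((z ^ i) η) with hv
  have hsum : 0 ≤ ∑ i ∈ range n, ‖v i‖ ^ 2 := sum_nonneg fun i _ => sq_nonneg _
  have hs : ∀ i < n, ‖v i‖ ≤ √(∑ i ∈ range n, ‖v i‖ ^ 2) := fun i hi =>
    Real.le_sqrt_of_sq_le (single_le_sum (f := fun i => ‖v i‖ ^ 2) (fun i _ => sq_nonneg _)
      (mem_range.2 hi))
  exact hankelForm_nonneg hn (θ := n * (κ * 2 ^ n)) (by positivity) hθ1 hθn.le hs
    (Real.sq_sqrt hsum).le fun i hi _ =>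
      norm_apply_pow_le hzκ hκ1 (by simp) hθ1 hs (Real.sqrt_nonneg _) hi

end Gap

/-! ### Strictness of the inclusion of `P_{n+1}` in `P_n` -/

section Gap

open Finset

theorem sum_antidiagonal_eq_of_eq_zero_of_lt {N : ℕ} {a : ℕ → ℝ} (ha : ∀ i < N, a i = 0)
    {k : ℕ} (hk : k < 2 * N) : ∑ p ∈ antidiagonal k, a p.1 * a p.2 = 0 := by
  refine sum_eq_zero fun p hp => ?_
  rw [HasAntidiagonal.mem_antidiagonal] at hp
  rcases lt_or_ge p.1 N with h | h
  · rw [ha _ h, zero_mul]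
  · rw [ha p.2 (by omega), mul_zero]

theorem sum_antidiagonal_two_mul {N : ℕ} {a : ℕ → ℝ} (ha : ∀ i < N, a i = 0) :
    ∑ p ∈ antidiagonal (2 * N), a p.1 * a p.2 = a N ^ 2 := by
  rw [sum_eq_single (N, N), sq]
  · intro p hp hne
    rw [HasAntidiagonal.mem_antidiagonal] at hp
    rcases lt_or_ge p.1 N with h | h
    · rw [ha _ h, zero_mul]
    · rw [ha p.2, mul_zero]
      by_contra h'
      exact hne (Prod.ext (by omega) (by omega))
  · intro h
    exact absurd (HasAntidiagonal.mem_antidiagonal.2 (by omega)) h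

theorem sum_antidiagonal_two_mul_add_one {N : ℕ} {a : ℕ → ℝ} (ha : ∀ i < N, a i = 0) :
    ∑ p ∈ antidiagonal (2 * N + 1), a p.1 * a p.2 = 2 * (a N * a (N + 1)) := by
  have hsub : {(N, N + 1), (N + 1, N)} ⊆ antidiagonal (2 * N + 1) := by
    intro p hp
    rw [HasAntidiagonal.mem_antidiagonal]
    rcases mem_insert.1 hp with rfl | hp
    · dsimp only; omega
    · rw [mem_singleton.1 hp]; omega
  rw [← sum_subset hsub, sum_pair (by simp)]
  · ring
  · intro p hp hne
    rw [HasAntidiagonal.mem_antidiagonal] at hp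
    rcases lt_or_ge p.1 N with h | h
    · rw [ha _ h, zero_mul]
    · rw [ha p.2, mul_zero]
      by_contra h'
      refine hne ?_
      rw [mem_insert, mem_singleton, Prod.ext_iff, Prod.ext_iff]
      dsimp only
      omega

/-- Moments can be prescribed, by the nonvanishing of the Vandermonde determinant. -/
theorem exists_moments {m : ℕ} {μ : Fin m → ℝ} (hμ : Function.Injective μ) (a : ℕ → ℝ) :
    ∃ w : Fin m → ℝ, ∀ i < m, ∑ j, w j * μ j ^ i = a i := by
  have hunit : IsUnit (Matrix.vandermonde μ) := by
    rw [Matrix.isUnit_iff_isUnit_det]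
    exact (Matrix.det_vandermonde_ne_zero_iff.2 hμ).isUnit
  obtain ⟨w, hw⟩ := Matrix.vecMul_surjective_iff_isUnit.2 hunit fun i => a i
  exact ⟨w, fun i hi => congrFun hw ⟨i, hi⟩⟩

/-- The diagonal operator with real eigenvalues `μ`. -/
noncomputable def diagonalOperator {m : ℕ} (μ : Fin m → ℝ) :
    EuclideanSpace ℂ (Fin m) →L[ℂ] EuclideanSpace ℂ (Fin m) :=
  Matrix.toEuclideanCLM (𝕜 := ℂ) (Matrix.diagonal fun j => (μ j : ℂ))

theorem diagonalOperator_pow_apply {m : ℕ} (μ : Fin m → ℝ) (i : ℕ) (η : EuclideanSpace ℂ (Fin m))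
    (j : Fin m) : (diagonalOperator μ ^ i) η j = (μ j : ℂ) ^ i * η j := by
  rw [diagonalOperator, ← map_pow, Matrix.diagonal_pow]
  simp [Matrix.ofLp_toEuclideanCLM, Matrix.mulVec_diagonal]

theorem diagonalOperator_nonneg {m : ℕ} {μ : Fin m → ℝ} (h : ∀ j, 0 ≤ μ j) :
    0 ≤ diagonalOperator μ := by
  have h1 : diagonalOperator μ =
      star (diagonalOperator fun j => √(μ j)) * diagonalOperator fun j => √(μ j) := by
    rw [diagonalOperator, diagonalOperator, ← map_star, ← map_mul, Matrix.star_eq_conjTranspose,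
      Matrix.diagonal_conjTranspose, Matrix.diagonal_mul_diagonal]
    congr 2
    ext j
    simp [← Complex.ofReal_mul, Real.mul_self_sqrt (h j)]
  rw [h1]
  exact star_mul_self_nonneg _

theorem diagonalOperator_sub {m : ℕ} (μ ν : Fin m → ℝ) :
    diagonalOperator (μ - ν) = diagonalOperator μ - diagonalOperator ν := by
  rw [diagonalOperator, diagonalOperator, diagonalOperator, ← map_sub, Matrix.diagonal_sub]
  simp

theorem diagonalOperator_const {m : ℕ} (r : ℝ) : diagonalOperator (fun _ : Fin m => r) =
    algebraMap ℝ (EuclideanSpace ℂ (Fin m) →L[ℂ] EuclideanSpace ℂ (Fin m)) r := by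
  ext η j
  have := diagonalOperator_pow_apply (fun _ : Fin m => r) 1 η j
  rw [pow_one, pow_one] at this
  rw [this, Algebra.algebraMap_eq_smul_one]
  simp

theorem diagonalOperator_le {m : ℕ} {μ ν : Fin m → ℝ} (h : ∀ j, μ j ≤ ν j) :
    diagonalOperator μ ≤ diagonalOperator ν := by
  rw [← sub_nonneg, ← diagonalOperator_sub]
  exact diagonalOperator_nonneg fun j => sub_nonneg.2 (h j)

/-- A polynomial of degree `2N + 2` without constant term and with positive leading coefficients is
not matrix monotone of order `N + 2` on any nontrivial interval. -/
theorem polySum_notMem_euclideanMonotoneClass {N : ℕ} {c : ℕ → ℝ} (hc : 0 < c (2 * N))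
    (hc' : 0 < c (2 * N + 1)) {α β : ℝ} (hαβ : α < β) :
    (polySum c (2 * N + 2) : ℝ → ℝ) ∉ euclideanMonotoneClass (N + 2) (Set.Icc α β) := by
  intro hmem
  -- The `N + 2` nodes `α + j δ` are distinct and leave a margin of at least `δ` below `β`.
  set δ := (β - α) / (N + 3) with hδ
  have hN : (0 : ℝ) < N + 3 := by positivity
  have hδ0 : 0 < δ := div_pos (sub_pos.2 hαβ) hN
  have hδβ : α + (N + 3) * δ = β := by rw [hδ]; field_simp; ring
  set μ : Fin (N + 2) → ℝ := fun j => α + (j : ℕ) * δ with hμ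
  have hμinj : Function.Injective μ := fun i j hij => by
    have h1 : ((i : ℕ) : ℝ) * δ = (j : ℕ) * δ := add_left_cancel hij
    exact Fin.ext (by exact_mod_cast mul_right_cancel₀ hδ0.ne' h1)
  -- With moments `0, …, 0, -τ, 1` only the last two antidiagonals survive, giving `c (2N) τ² - 2 c
  -- (2N+1) τ`. This `τ` minimises it, with a negative value; a term `c (2N+2)` would have entered
  -- here, but the polynomial stops before it.
  set τ := c (2 * N + 1) / c (2 * N) with hτ
  obtain ⟨w, hw⟩ := exists_moments hμinj
    fun i => if i < N then 0 else if i = N then -τ else 1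
  set a : ℕ → ℝ := fun i => ∑ j, w j * μ j ^ i with ha
  have ha0 : ∀ i < N, a i = 0 := fun i hi => (hw i (by omega)).trans (if_pos hi)
  have haN : a N = -τ := (hw N (by omega)).trans (by simp)
  have haN1 : a (N + 1) = 1 := (hw (N + 1) (by omega)).trans (by simp)
  let H := EuclideanSpace ℂ (Fin (N + 2))
  let e : H := EuclideanSpace.single 0 1
  -- A rank one operator that sums the coordinates: applied to powers of the diagonal operator at
  -- `η` it produces the moments `a i`.
  let b : H →L[ℂ] H := (innerSL ℂ (WithLp.toLp 2 fun _ => 1 : H)).smulRight e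
  let η : H := WithLp.toLp 2 fun j => (w j : ℂ)
  have hv : ∀ i, b ((diagonalOperator μ ^ i) η) = (a i : ℂ) • e := fun i => by
    change inner ℂ (WithLp.toLp 2 fun _ => 1 : H) ((diagonalOperator μ ^ i) η) • e = _
    congr 1
    rw [PiLp.inner_apply, ha, Complex.ofReal_sum]
    refine sum_congr rfl fun j _ => ?_
    rw [diagonalOperator_pow_apply]
    simp [η, mul_comm]
  have he : ‖e‖ = 1 := (PiLp.norm_single 2 _ 0 1).trans norm_one
  have hform : ∀ i j, (inner ℂ (b ((diagonalOperator μ ^ i) η))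
      (b ((diagonalOperator μ ^ j) η))).re = a i * a j := fun i j => by
    rw [hv, hv, inner_smul_left, inner_smul_right, Complex.conj_ofReal, inner_self_eq_norm_sq_to_K,
      he]
    simp
  have hlo : algebraMap ℝ (H →L[ℂ] H) α ≤ diagonalOperator μ := by
    rw [← diagonalOperator_const]
    exact diagonalOperator_le fun j => le_add_of_nonneg_right (by positivity)
  have hhi : diagonalOperator μ ≤ algebraMap ℝ (H →L[ℂ] H) (β - δ) := by
    rw [← diagonalOperator_const]
    refine diagonalOperator_le fun j => ?_
    have hj : ((j : ℕ) : ℝ) ≤ N + 2 := by exact_mod_cast j.2.le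
    have := mul_le_mul_of_nonneg_right hj hδ0.le
    simp only [hμ]
    linarith
  have h := nonneg_of_polySum_mem_monotoneClass hδ0 hmem (vectorFunctional η)
    (fun _ => vectorFunctional_nonneg) (star_mul_self_nonneg b) hlo hhi
  rw [sum_vectorFunctional_eq_hankelForm _ _ (isSelfAdjoint_of_algebraMap_le hlo), hankelForm] at h
  simp only [hform] at h
  rw [sum_range_succ, sum_range_succ, sum_antidiagonal_two_mul ha0,
    sum_antidiagonal_two_mul_add_one ha0, haN, haN1, sum_eq_zero, zero_add, hτ] at h
  · have h1 : c (2 * N) * (-(c (2 * N + 1) / c (2 * N))) ^ 2 +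
        c (2 * N + 1) * (2 * (-(c (2 * N + 1) / c (2 * N)) * 1)) =
        -(c (2 * N + 1) ^ 2 / c (2 * N)) := by
      field_simp
      ring
    rw [h1] at h
    have : 0 < c (2 * N + 1) ^ 2 / c (2 * N) := by positivity
    linarith
  · intro k hk
    rw [sum_antidiagonal_eq_of_eq_zero_of_lt ha0 (mem_range.1 hk), mul_zero]

/-- The witness is the polynomial pulled back along the chart `g`. Were it of order `n + 1`,
composing with the inverse chart would make the polynomial itself monotone of order `n + 1` on an
interval inside `g(I)`. -/
theorem exists_mem_euclideanMonotoneClass_notMem_succ_of_pos {I : Set ℝ} (hI : I.OrdConnected)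
    (hI' : I.Nontrivial) (hne : I ≠ Set.univ) {n : ℕ} (hn : 1 ≤ n) :
    ∃ f ∈ euclideanMonotoneClass n I, f ∉ euclideanMonotoneClass (n + 1) I := by
  obtain ⟨κ, hκ, hp⟩ := exists_polySum_mem_euclideanMonotoneClass hn
  obtain ⟨g, h, hgh, hmaps, hg, hh⟩ := exists_operatorMonotone_chart hI hne hκ
  refine ⟨_ ∘ g, monotoneClass_comp hp (hg n) hmaps, fun hmem => ?_⟩
  obtain ⟨x, hx, y, hy, hxy⟩ := hI'
  have hgxy : g x ≠ g y := fun h' => hxy (hgh.injOn hx hy h')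
  have huIcc : Set.uIcc x y ⊆ I := hI.uIcc_subset hx hy
  have hJ : Set.uIcc (g x) (g y) ⊆ g '' I :=
    (intermediate_value_uIcc ((hg n).1.mono huIcc)).trans (Set.image_mono huIcc)
  have hcomp := monotoneClass_comp hmem (hh (n + 1) _ hJ) fun s hs => by
    obtain ⟨t, ht, rfl⟩ := hJ hs
    rwa [hgh ht]
  have hp' := mem_monotoneClass_of_eqOn hcomp
    (g := polySum (fun k => (2 * n : ℝ) ^ (k ^ 2)) (2 * n)) fun s hs => by
      obtain ⟨t, ht, rfl⟩ := hJ hs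
      simp [hgh ht]
  -- With `n = N + 1` the degree `2n` is `2N + 2` and the order `n + 1` is `N + 2`.
  obtain ⟨N, rfl⟩ := Nat.exists_eq_add_of_le' hn
  exact polySum_notMem_euclideanMonotoneClass (by positivity) (by positivity)
    (min_lt_max.2 hgxy) hp'

theorem neg_notMem_euclideanMonotoneClass_one {I : Set ℝ} (hI : I.Nontrivial) :
    (fun t => -t) ∉ euclideanMonotoneClass 1 I := by
  intro h
  obtain ⟨p, hp, q, hq, hpq⟩ := hI.exists_lt
  have hsa : ∀ r : ℝ, IsSelfAdjoint (diagonalOperator fun _ : Fin 1 => r) := fun r => by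
    rw [diagonalOperator_const]
    exact .algebraMap _ (.all r)
  have hspec : ∀ r ∈ I, spectrum ℝ (diagonalOperator fun _ : Fin 1 => r) ⊆ I := fun r hr => by
    rw [diagonalOperator_const, spectrum.scalar_eq]
    simpa using hr
  have h1 := h.2 _ _ (hsa p) (hsa q) (hspec p hp) (hspec q hq) (diagonalOperator_le fun _ => hpq.le)
  rw [diagonalOperator_const, diagonalOperator_const, cfc_algebraMap, cfc_algebraMap,
    algebraMap_le_algebraMap] at h1
  linarith

/-- The classes `P_n(I)` and `P_{n + 1}(I)` are different, for every interval `I ≠ ℝ`. -/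
theorem exists_mem_euclideanMonotoneClass_notMem_succ {I : Set ℝ} (hI : I.OrdConnected)
    (hI' : I.Nontrivial) (hne : I ≠ Set.univ) (n : ℕ) :
    ∃ f ∈ euclideanMonotoneClass n I, f ∉ euclideanMonotoneClass (n + 1) I := by
  rcases Nat.eq_zero_or_pos n with rfl | hn
  · exact ⟨_, mem_monotoneClass_of_subsingleton continuous_neg.continuousOn,
      neg_notMem_euclideanMonotoneClass_one hI'⟩
  · exact exists_mem_euclideanMonotoneClass_notMem_succ_of_pos hI hI' hne hn

end Gap

/-! ### From irreducible representations to the theorem -/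

section Representations

variable {A : Type u} [CStarAlgebra A] [PartialOrder A] [StarOrderedRing A] {I : Set ℝ}

/-- A function that is monotone on the images of all irreducible representations is monotone
on `A`. -/
theorem mem_monotoneClass_of_forall_irreducibleRep {f : ℝ → ℝ} (hf : ContinuousOn f I)
    (h : ∀ (H : Type u) [NormedAddCommGroup H] [InnerProductSpace ℂ H] [CompleteSpace H]
      (π : A →⋆ₐ[ℂ] (H →L[ℂ] H)), IsIrreducibleRep π → f ∈ monotoneClass (H →L[ℂ] H) I) :
    f ∈ monotoneClass A I := by
  refine ⟨hf, fun x y hx hy hxI hyI hxy => ?_⟩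
  by_contra hlt
  rw [← sub_nonneg] at hlt
  obtain ⟨H, _, _, _, π, hπ, hneg⟩ := exists_irreducibleRep_not_nonneg
    ((cfc_predicate f y : IsSelfAdjoint _).sub (cfc_predicate f x)) hlt
  rw [map_sub, sub_nonneg] at hneg
  exact hneg (map_cfc_le_map_cfc π (h H π hπ) hx hy hxI hyI hxy)

theorem euclideanMonotoneClass_subset (hI : I.Nonempty) (hA : ¬ HasInfiniteDimIrrep A) {n : ℕ}
    (hn : n ∈ upperBounds (finiteIrrepDims A)) :
    euclideanMonotoneClass n I ⊆ monotoneClass A I := by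
  refine fun f hf => mem_monotoneClass_of_forall_irreducibleRep hf.1 fun H _ _ _ π hπ => ?_
  have hfin : FiniteDimensional ℂ H := by
    by_contra h
    exact hA ⟨H, _, _, _, π, hπ, h⟩
  exact (exists_linearIsometry_of_finrank_le
    (hn ⟨H, _, _, _, π, hπ, hfin, rfl⟩)).some.monotoneClass_subset hI hf

theorem monotoneClass_subset_of_mem_finiteIrrepDims (hI : I.OrdConnected) (hI' : I.Nontrivial)
    {n d : ℕ} (hd : d ∈ finiteIrrepDims A) (hnd : n ≤ d) :
    monotoneClass A I ⊆ euclideanMonotoneClass n I := by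
  obtain ⟨H, _, _, _, π, hπ, hfin, rfl⟩ := hd
  exact (hπ.monotoneClass_subset hI hI').trans
    ((exists_linearIsometry_of_le_finrank hnd).some.monotoneClass_subset hI'.nonempty)

theorem HasInfiniteDimIrrep.monotoneClass_subset (hA : HasInfiniteDimIrrep A)
    (hI : I.OrdConnected) (hI' : I.Nontrivial) (n : ℕ) :
    monotoneClass A I ⊆ euclideanMonotoneClass n I := by
  obtain ⟨H, _, _, _, π, hπ, hinf⟩ := hA
  exact (hπ.monotoneClass_subset hI hI').trans
    ((exists_linearIsometry_of_infinite hinf n).some.monotoneClass_subset hI'.nonempty)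

theorem mem_infMonotoneClass_iff {f : ℝ → ℝ} :
    f ∈ infMonotoneClass I ↔ ∀ n, 1 ≤ n → f ∈ euclideanMonotoneClass n I := by
  simp only [infMonotoneClass, matrixMonotoneClass_eq, Set.mem_iInter]

theorem infMonotoneClass_subset (hI : I.OrdConnected) (hI' : I.Nontrivial) :
    infMonotoneClass I ⊆ monotoneClass A I := fun _ hf =>
  have hf' := mem_infMonotoneClass_iff.1 hf
  mem_monotoneClass_of_forall_irreducibleRep (hf' 1 le_rfl).1
    fun _ _ _ _ _ _ => mem_monotoneClass_of_forall_euclidean hI hI' hf'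

theorem monotoneClass_eq_infMonotoneClass {H : Type v} [NormedAddCommGroup H]
    [InnerProductSpace ℂ H] [CompleteSpace H] (hH : ¬ FiniteDimensional ℂ H)
    (hI : I.OrdConnected) (hI' : I.Nontrivial) :
    monotoneClass (H →L[ℂ] H) I = infMonotoneClass I := by
  refine Set.Subset.antisymm (fun f hf => mem_infMonotoneClass_iff.2 fun n _ => ?_)
    fun f hf => mem_monotoneClass_of_forall_euclidean hI hI' (mem_infMonotoneClass_iff.1 hf)
  exact (exists_linearIsometry_of_infinite hH n).some.monotoneClass_subset hI'.nonempty hf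

/-- If all irreducible dimensions were at most `n`, then `P_n ⊆ P_A = P_∞ ⊆ P_{n+1}`, against the
gap. Conversely, dimensions that are unbounded or infinite put `P_A` inside every `P_n`. -/
theorem monotoneClass_eq_infMonotoneClass_iff (hI : I.OrdConnected) (hI' : I.Nontrivial)
    (hne : I ≠ Set.univ) : monotoneClass A I = infMonotoneClass I ↔
      (¬ BddAbove (finiteIrrepDims A) ∨ HasInfiniteDimIrrep A) := by
  refine ⟨fun h => ?_, fun h => (Set.Subset.antisymm (fun f hf => ?_)
    (infMonotoneClass_subset hI hI'))⟩
  · by_contra! hcon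
    obtain ⟨⟨n, hn⟩, hinf⟩ := hcon
    obtain ⟨f, hf, hf'⟩ := exists_mem_euclideanMonotoneClass_notMem_succ hI hI' hne n
    have hfA := euclideanMonotoneClass_subset hI'.nonempty hinf hn hf
    rw [h] at hfA
    exact hf' (mem_infMonotoneClass_iff.1 hfA _ n.succ_pos)
  · refine mem_infMonotoneClass_iff.2 fun n _ => ?_
    rcases h with h | h
    · obtain ⟨d, hd, hnd⟩ := not_bddAbove_iff.1 h n
      exact monotoneClass_subset_of_mem_finiteIrrepDims hI hI' hd hnd.le hf
    · exact h.monotoneClass_subset hI hI' n hf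

theorem monotoneClass_eq_euclideanMonotoneClass_iff (hI : I.OrdConnected) (hI' : I.Nontrivial)
    (hne : I ≠ Set.univ) {n : ℕ} (hn : 1 ≤ n) :
    monotoneClass A I = euclideanMonotoneClass n I ↔ IsSubhomogeneousOfDegree A n := by
  refine ⟨fun h => ?_, fun ⟨hinf, hmem, hub⟩ => (monotoneClass_subset_of_mem_finiteIrrepDims hI hI'
    hmem le_rfl).antisymm (euclideanMonotoneClass_subset hI'.nonempty hinf hub)⟩
  -- The gap above `n` excludes irreducible representations of dimension greater than `n`, finite or
  -- infinite.
  have hnot : ¬ monotoneClass A I ⊆ euclideanMonotoneClass (n + 1) I := fun hsub => by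
    obtain ⟨f, hf, hf'⟩ := exists_mem_euclideanMonotoneClass_notMem_succ hI hI' hne n
    exact hf' (hsub (h ▸ hf))
  have hinf : ¬ HasInfiniteDimIrrep A := fun hA => hnot (hA.monotoneClass_subset hI hI' _)
  have hub : n ∈ upperBounds (finiteIrrepDims A) := fun d hd => by
    by_contra! hlt
    exact hnot (monotoneClass_subset_of_mem_finiteIrrepDims hI hI' hd hlt)
  refine ⟨hinf, ?_, hub⟩
  by_contra hmem
  -- If `n = m + 1` is not attained, all dimensions are at most `m`, so `P_m ⊆ P_A = P_{m+1}`,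
  -- against the gap at `m`; here `m = 0` can occur.
  obtain ⟨m, rfl⟩ := Nat.exists_eq_add_of_le' hn
  have hub' : m ∈ upperBounds (finiteIrrepDims A) := fun d hd =>
    Nat.lt_succ_iff.1 ((hub hd).lt_of_ne fun h' => hmem (h' ▸ hd))
  obtain ⟨f, hf, hf'⟩ := exists_mem_euclideanMonotoneClass_notMem_succ hI hI' hne m
  exact hf' (h ▸ euclideanMonotoneClass_subset hI'.nonempty hinf hub' hf)

end Representations

theorem theorem2p3 (A : Type u) [CStarAlgebra A] [PartialOrder A] [StarOrderedRing A]
    (I : Set ℝ) (hI : I.OrdConnected) (hI_nontrivial : I.Nontrivial) (hI_ne : I ≠ Set.univ) :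
    (monotoneClass A I = infMonotoneClass I ↔
      (¬ BddAbove (finiteIrrepDims A) ∨ HasInfiniteDimIrrep A)) ∧
    (∀ (H : Type v) [NormedAddCommGroup H] [InnerProductSpace ℂ H] [CompleteSpace H],
      ¬ FiniteDimensional ℂ H →
      (monotoneClass A I = monotoneClass (H →L[ℂ] H) I ↔
        (¬ BddAbove (finiteIrrepDims A) ∨ HasInfiniteDimIrrep A))) ∧
    (∀ n : ℕ, 1 ≤ n →
      (monotoneClass A I = matrixMonotoneClass n I ↔ IsSubhomogeneousOfDegree A n)) := by
  have h := monotoneClass_eq_infMonotoneClass_iff (A := A) hI hI_nontrivial hI_ne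
  refine ⟨h, fun H _ _ _ hH => ?_, fun n hn => ?_⟩
  · rwa [monotoneClass_eq_infMonotoneClass hH hI hI_nontrivial]
  · rw [matrixMonotoneClass_eq]
    exact monotoneClass_eq_euclideanMonotoneClass_iff hI hI_nontrivial hI_ne hn
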